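/- Let $D$ be a division algebra of finite degree $d$ over its center $C$ (so $[D:C]=d^2$), and let $\sigma$ be a ring automorphism of $D$ of finite order $n$ modulo inner automorphisms, with $\sigma^n(z)=uzu^{-1}$ for all $z\in D$, where $u\in D^\times$ and $\sigma(u)=u$. Let $R=D[t;\sigma]$ (with $ta=\sigma(a)t$ for $a\in D$) and $F=C\cap{\rm Fix}(\sigma)$. Let $f\in R$ be monic and irreducible of degree $m>1$, with no non-unit common right divisor with $t$, and not right-invariant (that is, $Rf$ is not a two-sided ideal). Let $h(t)=\hat h(u^{-1}t^n)$, with $\hat h\in F[x]$ monic, be the minimal central left multiple of $f$, i.e. the element of minimal degree among the nonzero elements of $F[u^{-1}t^n]\cap Rf$; put $E_{\hat h}=F[x]/(\hat h)$, and let $k$ be the number of irreducible factors in a factorization of $h$ in $R$. Let $S_f$ be the nonassociative ring of all $g\in R$ with $\deg g<m$, whose product of $g_1,g_2$ is the remainder of $g_1g_2$ under right division by $f$, and let $B={\rm Nuc}_r(S_f)=\{b\in S_f : (xy)b=x(yb)\ \text{for all}\ x,y\in S_f\}$. Then $V_f=R/Rf$ is a left $R$-module and a right $B$-module via $(a+Rf)b=ab+Rf$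 (for $\deg a<m$). Let $\rho$ be a ring automorphism of $D$ such that $F$ is finite-dimensional over $F'={\rm Fix}(\rho)\cap F$, let $\nu\in D$, let $l$ be an integer with $0<l<k$, and let $$A=\Big\{\sum_{i=0}^{lm-1}d_it^i+\nu\rho(d_0)t^{lm} : d_i\in D\Big\},\qquad S=S_{n,m,l}(\nu,\rho,f)=\{a+Rh : a\in A\}\subseteq R/Rh.$$ Suppose that $A$ contains no polynomial of degree $lm$ all of whose irreducible factors are similar to $f$ (where $p$ is similar to $f$ if $R/Rp\cong R/Rf$ as left $R$-modules). Then $B$ is a division algebra, finite-dimensional over $F'$, and $V_f$ has a right $B$-basis with $k$ elements. For every such basis, let $M_a\in M_k(B)$ be the matrix of the left multiplication $x\mapsto ax$ of $V_f$, and let $\mathcal C=\{M_a : a+Rh\in S\}\subseteq M_k(B)$. Then $\mathcal C$ is an $F'$-linear generalized MRD code with minimum distance $k-l+1$. This means that $\mathcal C$ is an $F'$-subspace of $M_k(B)$, that the minimum $d_{\mathcal C}$ of the column ranks (dimensions of the right $B$-modules generated by the columns) of the differences of two distinct elements of $\mathcal C$ equals $k-l+1$, and that the Singleton-like bound is attained: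 $\dim_{F'}\mathcal C=k(k-d_{\mathcal C}+1)[B:F']$. Moreover, if $\deg(h)=dmn$, then $k=dn$, there is an isomorphism of $F$-algebras $E_{\hat h}\cong B$ that sends the class of $x$ to the remainder of $u^{-1}t^n$ under right division by $f$, and under the identification $M_k(B)=M_{dn}(E_{\hat h})$ that it induces entrywise, $\mathcal C$ is an $F'$-linear (generalized) MRD code in $M_{dn}(E_{\hat h})$ with minimum distance $dn-l+1$. -/

import Mathlib

open scoped Polynomial

noncomputable section

namespace SkewMRD

open SkewPolynomial MulOpposite

/-! ### Degrees and right division in `D[t;σ]`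

`SkewPolynomial D` is the ring `D[t;σ]` with `t a = σ(a) t`; Mathlib encodes the endomorphism `σ`
by an action of `Multiplicative ℕ` on `D`, and calls it `SkewPolynomial.φ`. -/

section Division

variable {D : Type*} [DivisionRing D]

/-- The degree of a skew polynomial, with the value `0` at the zero polynomial. -/
def natDegree (p : SkewPolynomial D) : ℕ := p.support.sup id

theorem coeff_eq_zero_of_lt {p : SkewPolynomial D} {i : ℕ} (h : natDegree p < i) :
    coeff p i = 0 := by
  by_contra hne
  have h1 : i ≤ natDegree p := Finset.le_sup (f := id) (mem_support_iff.2 hne)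
  omega

theorem coeff_natDegree_ne_zero {p : SkewPolynomial D} (hp : p ≠ 0) :
    coeff p (natDegree p) ≠ 0 := by
  have hne : p.support.Nonempty :=
    Finset.nonempty_iff_ne_empty.2 (fun h => hp (support_eq_empty.1 h))
  obtain ⟨i, hi, hi'⟩ := Finset.exists_mem_eq_sup _ hne (id : ℕ → ℕ)
  have : natDegree p = i := hi'
  rw [this]
  exact mem_support_iff.1 hi

theorem coeff_smul' (c : D) (p : SkewPolynomial D) (i : ℕ) : coeff (c • p) i = c * coeff p i := rfl

/-- The space of representatives for division by `f`: if `f ≠ 0` has degree `m`, this is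
`R_m = {g | deg g < m}`, and it is everything for `f = 0`. -/
def reduced (f : SkewPolynomial D) : Submodule D (SkewPolynomial D) where
  carrier := {g | f ≠ 0 → ∀ i, natDegree f ≤ i → coeff g i = 0}
  add_mem' ha hb h0 i hi := by simp [ha h0 i hi, hb h0 i hi]
  zero_mem' _ _ _ := by simp
  smul_mem' c g hg h0 i hi := by rw [coeff_smul', hg h0 i hi, mul_zero]

variable [MulSemiringAction (Multiplicative ℕ) D]

theorem coeff_monomial_mul (N : ℕ) (c : D) (p : SkewPolynomial D) (i : ℕ) :
    coeff (monomial N c * p) (N + i) = c * φ^[N] (coeff p i) := by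
  rw [φ_iterate_apply]
  exact SkewMonoidAlgebra.coeff_single_mul_aux p (fun a => by
    change Multiplicative.ofAdd N * a = Multiplicative.ofAdd N * Multiplicative.ofAdd i ↔ _
    exact mul_left_cancel_iff)

theorem iterate_eq_zero {N : ℕ} {c : D} : φ^[N] c = 0 ↔ c = 0 := by
  rw [φ_iterate_apply]
  exact map_eq_zero (MulSemiringAction.toRingHom (Multiplicative ℕ) D (Multiplicative.ofAdd N))

theorem coeff_mul_eq_sum (q p : SkewPolynomial D) (i : ℕ) :
    coeff (q * p) i = ∑ j ∈ q.support, coeff (monomial j (coeff q j) * p) i := by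
  let ev : SkewPolynomial D →+ D :=
    { toFun := fun g => coeff g i, map_zero' := by simp, map_add' := by simp }
  have h1 : q * p = ∑ j ∈ q.support, monomial j (coeff q j) * p := by
    conv_lhs => rw [← sum_monomial q, sum_def, Finset.sum_mul]
  have h2 : ev (q * p) = ∑ j ∈ q.support, ev (monomial j (coeff q j) * p) := by
    conv_lhs => rw [h1]
    exact map_sum ev _ _
  exact h2

theorem coeff_mul_top {q p : SkewPolynomial D} {a b : ℕ} (ha : ∀ i, a < i → coeff q i = 0)
    (hb : ∀ i, b < i → coeff p i = 0) :
    coeff (q * p) (a + b) = coeff q a * φ^[a] (coeff p b) := by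
  have key : ∀ j, j ∈ q.support → j ≠ a → coeff (monomial j (coeff q j) * p) (a + b) = 0 := by
    intro j hj hja
    have hj' : j ≤ a := by
      by_contra hlt
      exact mem_support_iff.1 hj (ha j (by omega))
    have he : a + b = j + (a + b - j) := by omega
    rw [he, coeff_monomial_mul, hb _ (by omega), iterate_eq_zero.2 rfl, mul_zero]
  rw [coeff_mul_eq_sum, Finset.sum_eq_single a key, coeff_monomial_mul]
  intro h
  rw [notMem_support_iff.1 h]
  simp

theorem coeff_mul_above {q p : SkewPolynomial D} {a b : ℕ} (ha : ∀ i, a < i → coeff q i = 0)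
    (hb : ∀ i, b < i → coeff p i = 0) {i : ℕ} (hi : a + b < i) : coeff (q * p) i = 0 := by
  rw [coeff_mul_eq_sum]
  refine Finset.sum_eq_zero fun j hj => ?_
  have hj' : j ≤ a := by
    by_contra hlt
    exact mem_support_iff.1 hj (ha j (by omega))
  have he : i = j + (i - j) := by omega
  rw [he, coeff_monomial_mul, hb _ (by omega), iterate_eq_zero.2 rfl, mul_zero]

/-- Existence of the remainder of right division by `f`. -/
theorem exists_mem_reduced (f g : SkewPolynomial D) :
    ∃ r ∈ reduced f, g - r ∈ Ideal.span {f} := by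
  by_cases hf : f = 0
  · exact ⟨g, fun h => absurd hf h, by simp⟩
  have main : ∀ (N : ℕ) (g : SkewPolynomial D), (∀ i, N ≤ i → coeff g i = 0) →
      ∃ r ∈ reduced f, g - r ∈ Ideal.span {f} := by
    intro N
    induction N with
    | zero =>
      intro g hg
      have : g = 0 := by ext i; simpa using hg i (Nat.zero_le i)
      exact ⟨0, zero_mem _, by simp [this]⟩
    | succ N ih =>
      intro g hg
      by_cases hN : natDegree f ≤ N
      · obtain ⟨e, rfl⟩ : ∃ e, N = e + natDegree f := ⟨N - natDegree f, by omega⟩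
        let q : SkewPolynomial D :=
          monomial e (coeff g (e + natDegree f) * (φ^[e] (coeff f (natDegree f)))⁻¹)
        have hq : ∀ i, e < i → coeff q i = 0 := fun i hi => by
          simp only [q]; rw [coeff_monomial, if_neg (by omega)]
        have hfb : ∀ i, natDegree f < i → coeff f i = 0 := fun i hi => coeff_eq_zero_of_lt hi
        obtain ⟨r, hr, hgr⟩ := ih (g - q * f) (by
          intro i hi
          rw [coeff_sub]
          rcases Nat.lt_or_ge (e + natDegree f) i with h | h
          · rw [hg i (by omega), coeff_mul_above hq hfb h, sub_zero]
          · obtain rfl : i = e + natDegree f := by omega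
            rw [coeff_mul_top hq hfb]
            simp only [q]
            rw [coeff_monomial, if_pos rfl, inv_mul_cancel_right₀, sub_self]
            exact fun h0 => coeff_natDegree_ne_zero hf (iterate_eq_zero.1 h0))
        refine ⟨r, hr, ?_⟩
        have : g - r = (g - q * f - r) + q * f := by abel
        rw [this]
        exact add_mem hgr (Ideal.mul_mem_left _ _ (Ideal.mem_span_singleton_self f))
      · exact ⟨g, fun _ i hi => hg i (by omega), by simp⟩
  exact main (natDegree g + 1) g fun i hi => coeff_eq_zero_of_lt hi

/-- Uniqueness of the remainder of right division by `f`. -/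
theorem eq_of_mem_reduced {f r s : SkewPolynomial D} (hr : r ∈ reduced f) (hs : s ∈ reduced f)
    (h : r - s ∈ Ideal.span {f}) : r = s := by
  obtain ⟨q, hq⟩ := Ideal.mem_span_singleton'.1 h
  rw [← sub_eq_zero, ← hq]
  by_cases hf : f = 0
  · simp [hf]
  by_contra hne
  have hq0 : q ≠ 0 := fun h0 => hne (by simp [h0])
  have h1 := coeff_mul_top (q := q) (p := f) (fun i hi => coeff_eq_zero_of_lt hi)
    (fun i hi => coeff_eq_zero_of_lt hi)
  rw [hq, (sub_mem hr hs : r - s ∈ reduced f) hf _ (by omega)] at h1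
  exact mul_ne_zero (coeff_natDegree_ne_zero hq0)
    (fun h0 => coeff_natDegree_ne_zero hf (iterate_eq_zero.1 h0)) h1.symm

/-- The remainder `g mod_r f` of right division by `f`: `g = q f + r` with `deg r < deg f`
(and `r = g` if `f = 0`). -/
def modR (f g : SkewPolynomial D) : SkewPolynomial D := (exists_mem_reduced f g).choose

theorem modR_mem (f g : SkewPolynomial D) : modR f g ∈ reduced f :=
  (exists_mem_reduced f g).choose_spec.1

theorem sub_modR_mem (f g : SkewPolynomial D) : g - modR f g ∈ Ideal.span {f} :=
  (exists_mem_reduced f g).choose_spec.2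

theorem modR_eq {f g r : SkewPolynomial D} (hr : r ∈ reduced f)
    (h : g - r ∈ Ideal.span {f}) : modR f g = r := by
  refine eq_of_mem_reduced (modR_mem f g) hr ?_
  have : modR f g - r = (g - r) - (g - modR f g) := by abel
  rw [this]
  exact sub_mem h (sub_modR_mem f g)

theorem modR_congr {f g g' : SkewPolynomial D} (h : g - g' ∈ Ideal.span {f}) :
    modR f g = modR f g' := by
  refine modR_eq (modR_mem f g') ?_
  have : g - modR f g' = (g - g') + (g' - modR f g') := by abel
  rw [this]
  exact add_mem h (sub_modR_mem f g')

theorem modR_of_mem {f g : SkewPolynomial D} (h : g ∈ reduced f) : modR f g = g :=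
  modR_eq h (by simp)

theorem modR_add (f g g' : SkewPolynomial D) : modR f (g + g') = modR f g + modR f g' := by
  refine modR_eq (add_mem (modR_mem f g) (modR_mem f g')) ?_
  have : g + g' - (modR f g + modR f g') = (g - modR f g) + (g' - modR f g') := by abel
  rw [this]
  exact add_mem (sub_modR_mem f g) (sub_modR_mem f g')

theorem modR_smul (f : SkewPolynomial D) (c : D) (g : SkewPolynomial D) :
    modR f (c • g) = c • modR f g := by
  refine modR_eq (Submodule.smul_mem _ c (modR_mem f g)) ?_
  have : c • g - c • modR f g = C c * (g - modR f g) := by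
    ext i
    have h := coeff_monomial_mul 0 c (g - modR f g) i
    rw [zero_add] at h
    rw [← monomial_zero_left, h]
    simp [coeff_smul', mul_sub]
  rw [this]
  exact Ideal.mul_mem_left _ _ (sub_modR_mem f g)

end Division

/-! ### The fields `F = C ∩ Fix(σ)` and `F' = Fix(ρ) ∩ F` -/

section Fields

variable (D : Type*) [DivisionRing D] [MulSemiringAction (Multiplicative ℕ) D]

/-- `C ∩ Fix(σ)` as a subfield of `D`, where `C` is the center of `D`. -/
def fixedCenter : Subfield D where
  carrier := {c | c ∈ Subring.center D ∧ φ c = c}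
  mul_mem' ha hb := ⟨mul_mem ha.1 hb.1, by rw [map_mul, ha.2, hb.2]⟩
  one_mem' := ⟨one_mem _, map_one _⟩
  add_mem' ha hb := ⟨add_mem ha.1 hb.1, by rw [map_add, ha.2, hb.2]⟩
  zero_mem' := ⟨zero_mem _, map_zero _⟩
  neg_mem' ha := ⟨neg_mem ha.1, by rw [map_neg, ha.2]⟩
  inv_mem' c hc := by
    refine ⟨?_, by rw [map_inv₀, hc.2]⟩
    have := hc.1
    rw [Subring.mem_center_iff] at this ⊢
    exact fun g => (Commute.inv_right₀ (this g : Commute g c)).eq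

/-- The field `F = C ∩ Fix(σ)`. -/
def FieldF : Type _ := fixedCenter D

variable {D}

/-- `Fix(ρ) ∩ C ∩ Fix(σ)` as a subfield of `D`. -/
def fixedCenterFix (ρ : D ≃+* D) : Subfield D where
  carrier := {c | c ∈ fixedCenter D ∧ ρ c = c}
  mul_mem' ha hb := ⟨mul_mem ha.1 hb.1, by rw [map_mul, ha.2, hb.2]⟩
  one_mem' := ⟨one_mem _, map_one _⟩
  add_mem' ha hb := ⟨add_mem ha.1 hb.1, by rw [map_add, ha.2, hb.2]⟩
  zero_mem' := ⟨zero_mem _, map_zero _⟩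
  neg_mem' ha := ⟨neg_mem ha.1, by rw [map_neg, ha.2]⟩
  inv_mem' c hc := ⟨inv_mem hc.1, by rw [map_inv₀, hc.2]⟩

/-- The field `F' = Fix(ρ) ∩ F`. -/
def FieldF' (ρ : D ≃+* D) : Type _ := fixedCenterFix ρ

theorem fixedCenter_comm {c : D} (hc : c ∈ fixedCenter D) (a : D) : a * c = c * a :=
  Subring.mem_center_iff.1 hc.1 a

theorem fixedCenter_smul {c : D} (hc : c ∈ fixedCenter D) (k : Multiplicative ℕ) : k • c = c := by
  have h : ∀ j : ℕ, φ^[j] c = c := fun j => Function.iterate_fixed hc.2 j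
  have := φ_iterate_apply (Multiplicative.toAdd k) c
  rw [h] at this
  exact this.symm

instance : Field (FieldF D) :=
  { (inferInstance : DivisionRing (fixedCenter D)) with
    mul_comm := fun a b => Subtype.ext (fixedCenter_comm b.2 a.1) }

instance : Algebra (FieldF D) D where
  algebraMap := (fixedCenter D).subtype
  smul c a := c.1 * a
  commutes' c a := (fixedCenter_comm c.2 a).symm
  smul_def' _ _ := rfl

instance : SMulCommClass (Multiplicative ℕ) (FieldF D) D where
  smul_comm k c a := by
    change k • (c.1 * a) = c.1 * k • a
    rw [smul_mul', fixedCenter_smul c.2]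

variable (ρ : D ≃+* D)

instance : Field (FieldF' ρ) :=
  { (inferInstance : DivisionRing (fixedCenterFix ρ)) with
    mul_comm := fun a b => Subtype.ext (fixedCenter_comm b.2.1 a.1) }

instance : Algebra (FieldF' ρ) D where
  algebraMap := (fixedCenterFix ρ).subtype
  smul c a := c.1 * a
  commutes' c a := (fixedCenter_comm c.2.1 a).symm
  smul_def' _ _ := rfl

instance : SMulCommClass (Multiplicative ℕ) (FieldF' ρ) D where
  smul_comm k c a := by
    change k • (c.1 * a) = c.1 * k • a
    rw [smul_mul', fixedCenter_smul c.2.1]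

/-- The inclusion `F' ⊆ F`. -/
instance : Algebra (FieldF' ρ) (FieldF D) :=
  RingHom.toAlgebra
    { toFun := fun c => ⟨c.1, c.2.1⟩
      map_one' := rfl
      map_mul' := fun _ _ => rfl
      map_zero' := rfl
      map_add' := fun _ _ => rfl }

instance : IsScalarTower (FieldF' ρ) (FieldF D) D where
  smul_assoc a b c := mul_assoc a.1 b.1 c

end Fields

/-! ### The right nucleus of a nonassociative ring -/

section Nucleus

variable (S : Type*) [NonAssocRing S]

/-- The right nucleus `Nuc_r(S) = {b | (x y) b = x (y b) for all x, y}`. -/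
def rightNucleus : AddSubgroup S where
  carrier := {b | ∀ x y : S, x * y * b = x * (y * b)}
  add_mem' ha hb x y := by rw [mul_add, mul_add, mul_add, ha, hb]
  zero_mem' x y := by simp
  neg_mem' ha x y := by rw [mul_neg, mul_neg, mul_neg, ha]

variable {S}

instance : Ring (rightNucleus S) :=
  { (inferInstance : AddCommGroup (rightNucleus S)) with
    mul := fun a b => ⟨a * b, fun x y => by
      rw [← b.2, a.2, b.2, b.2]⟩
    one := ⟨1, fun x y => by simp⟩
    mul_assoc := fun a b c => Subtype.ext (c.2 a b)
    one_mul := fun a => Subtype.ext (one_mul (a : S))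
    mul_one := fun a => Subtype.ext (mul_one (a : S))
    left_distrib := fun a b c => Subtype.ext (mul_add (a : S) b c)
    right_distrib := fun a b c => Subtype.ext (add_mul (a : S) b c)
    zero_mul := fun a => Subtype.ext (zero_mul (a : S))
    mul_zero := fun a => Subtype.ext (mul_zero (a : S)) }

variable {k : Type*} [Field k] [Module k S] [IsScalarTower k S S] [SMulCommClass k S S]

instance : Module k (rightNucleus S) where
  smul c b := ⟨c • (b : S), fun x y => by
    rw [mul_smul_comm, mul_smul_comm, mul_smul_comm, b.2]⟩
  one_smul b := Subtype.ext (one_smul k (b : S))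
  mul_smul c c' b := Subtype.ext (mul_smul c c' (b : S))
  smul_zero c := Subtype.ext (smul_zero c)
  smul_add c b b' := Subtype.ext (smul_add c (b : S) b')
  add_smul c c' b := Subtype.ext (add_smul c c' (b : S))
  zero_smul b := Subtype.ext (zero_smul k (b : S))

instance : Algebra k (rightNucleus S) :=
  Algebra.ofModule
    (fun c a b => Subtype.ext (smul_mul_assoc c (a : S) (b : S)))
    (fun c a b => Subtype.ext (mul_smul_comm c (a : S) (b : S)))

end Nucleus

/-! ### Petit algebras -/

section Petit

variable {D : Type*} [DivisionRing D] [MulSemiringAction (Multiplicative ℕ) D]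

/-- The Petit algebra `S_f`: the set `R_m = {g | deg g < m}`, `m = deg f`, with the
multiplication `g ∘ h = g h mod_r f`. -/
def PetitAlgebra (f : SkewPolynomial D) : Type _ := reduced f

instance (f : SkewPolynomial D) : AddCommGroup (PetitAlgebra f) :=
  inferInstanceAs (AddCommGroup (reduced f))

instance (k : Type*) [Field k] [Algebra k D] (f : SkewPolynomial D) : Module k (PetitAlgebra f) :=
  inferInstanceAs (Module k (reduced f))

/-- The skew polynomial of degree less than `deg f` underlying an element of `S_f`. -/
def PetitAlgebra.val {f : SkewPolynomial D} (x : PetitAlgebra f) : SkewPolynomial D :=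
  Subtype.val (p := (· ∈ reduced f)) x

/-- The class of `g mod_r f` in `S_f`. -/
def PetitAlgebra.mk (f g : SkewPolynomial D) : PetitAlgebra f := ⟨modR f g, modR_mem f g⟩

set_option linter.unusedSectionVars false

namespace PetitAlgebra

variable {f : SkewPolynomial D}

theorem ext' {x y : PetitAlgebra f} (h : x.val = y.val) : x = y := Subtype.ext h

theorem val_mem (x : PetitAlgebra f) : x.val ∈ reduced f := x.2

theorem val_add (x y : PetitAlgebra f) : (x + y).val = x.val + y.val := rfl

theorem val_zero : (0 : PetitAlgebra f).val = 0 := rfl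

theorem val_smul {k : Type*} [Field k] [Algebra k D] (c : k) (x : PetitAlgebra f) :
    (c • x).val = c • x.val := rfl

theorem val_mk (g : SkewPolynomial D) : (mk f g).val = modR f g := rfl

theorem mk_add (g g' : SkewPolynomial D) : mk f (g + g') = mk f g + mk f g' :=
  ext' (modR_add f g g')

theorem mk_smul {k : Type*} [Field k] [Algebra k D] (c : k) (g : SkewPolynomial D) :
    mk f (c • g) = c • mk f g := by
  refine ext' ?_
  rw [val_smul, val_mk, val_mk, ← algebraMap_smul D c g, ← algebraMap_smul D c (modR f g),
    modR_smul]

theorem mk_zero : mk f 0 = 0 := ext' (modR_of_mem (zero_mem _))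

theorem mk_val (x : PetitAlgebra f) : mk f x.val = x := ext' (modR_of_mem x.val_mem)

theorem mk_congr {g g' : SkewPolynomial D} (h : g - g' ∈ Ideal.span {f}) : mk f g = mk f g' :=
  ext' (modR_congr h)

instance : Mul (PetitAlgebra f) := ⟨fun x y => mk f (x.val * y.val)⟩

instance : One (PetitAlgebra f) := ⟨mk f 1⟩

theorem mul_def' (x y : PetitAlgebra f) : x * y = mk f (x.val * y.val) := rfl

theorem one_def' : (1 : PetitAlgebra f) = mk f 1 := rfl

/-- Either `1` has degree less than `deg f`, or `f` is a nonzero constant and `S_f = 0`. -/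
theorem one_cases (f : SkewPolynomial D) :
    (1 : PetitAlgebra f).val = 1 ∨ Subsingleton (PetitAlgebra f) := by
  by_cases h : f ≠ 0 ∧ natDegree f = 0
  · right
    have h0 : ∀ x : PetitAlgebra f, x.val = 0 := fun x => by
      ext i
      simpa using x.val_mem h.1 i (by omega)
    exact ⟨fun x y => ext' (by rw [h0, h0])⟩
  · left
    refine modR_of_mem fun hf i hi => ?_
    rw [coeff_one, if_neg]
    intro h0
    exact h ⟨hf, by omega⟩

instance : NonAssocRing (PetitAlgebra f) :=
  { (inferInstance : AddCommGroup (PetitAlgebra f)) with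
    one_mul := fun x => by
      rcases one_cases f with h | h
      · rw [mul_def', h, one_mul, mk_val]
      · exact Subsingleton.elim _ _
    mul_one := fun x => by
      rcases one_cases f with h | h
      · rw [mul_def', h, mul_one, mk_val]
      · exact Subsingleton.elim _ _
    left_distrib := fun x y z => by
      rw [mul_def', val_add, mul_add, mk_add]; rfl
    right_distrib := fun x y z => by
      rw [mul_def', val_add, add_mul, mk_add]; rfl
    zero_mul := fun x => by rw [mul_def', val_zero, zero_mul, mk_zero]
    mul_zero := fun x => by rw [mul_def', val_zero, mul_zero, mk_zero] }

variable {k : Type*} [Field k] [Algebra k D] [SMulCommClass (Multiplicative ℕ) k D]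

instance : IsScalarTower k (PetitAlgebra f) (PetitAlgebra f) where
  smul_assoc c x y := by
    change (c • x) * y = c • (x * y)
    rw [mul_def', mul_def', ← mk_smul, val_smul, smul_mul_assoc]

instance : SMulCommClass k (PetitAlgebra f) (PetitAlgebra f) where
  smul_comm c x y := by
    change c • (x * y) = x * (c • y)
    rw [mul_def', mul_def', ← mk_smul, val_smul, mul_smul_comm]

end PetitAlgebra

/-- The algebra `B = Nuc_r(S_f)`. -/
abbrev NucB (f : SkewPolynomial D) : Type _ := rightNucleus (PetitAlgebra f)

/-- The left `R`-module `V_f = R / R f`. -/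
abbrev V (f : SkewPolynomial D) : Type _ := SkewPolynomial D ⧸ Ideal.span {f}

/-- The representative of degree less than `deg f` of an element of `V_f`. -/
def rep {f : SkewPolynomial D} (x : V f) : PetitAlgebra f :=
  Quotient.liftOn' x (PetitAlgebra.mk f) fun _ _ h =>
    PetitAlgebra.mk_congr ((Submodule.quotientRel_def _).1 h)

section RightModule

variable {f : SkewPolynomial D}

theorem rep_mk (g : SkewPolynomial D) :
    rep (Submodule.Quotient.mk g : V f) = PetitAlgebra.mk f g := rfl

theorem rep_add (x y : V f) : rep (x + y) = rep x + rep y := by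
  obtain ⟨g, rfl⟩ := Submodule.Quotient.mk_surjective _ x
  obtain ⟨g', rfl⟩ := Submodule.Quotient.mk_surjective _ y
  rw [← Submodule.Quotient.mk_add, rep_mk, rep_mk, rep_mk, PetitAlgebra.mk_add]

theorem rep_zero : rep (0 : V f) = 0 := PetitAlgebra.mk_zero

/-- The class `g + R f` of an element `g` of `S_f`. -/
def toV (x : PetitAlgebra f) : V f := Submodule.Quotient.mk x.val

theorem rep_toV (x : PetitAlgebra f) : rep (toV x) = x := by
  rw [toV, rep_mk, PetitAlgebra.mk_val]

theorem toV_rep (x : V f) : toV (rep x) = x := by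
  obtain ⟨g, rfl⟩ := Submodule.Quotient.mk_surjective _ x
  rw [rep_mk]
  refine ((Submodule.Quotient.eq _).2 ?_).symm
  exact sub_modR_mem f g

theorem toV_add (x y : PetitAlgebra f) : toV (x + y) = toV x + toV y := rfl

/-- The right scalar multiplication of `V_f` by `B`: `(a + R f) (z + R f) = a z + R f` for `z ∈ B`
and `deg a < deg f`. -/
def rightMul (x : V f) (b : NucB f) : V f := toV (rep x * (b : PetitAlgebra f))

/-- The right `B`-module structure of `V_f`. Right `B`-modules are modules over `Bᵐᵒᵖ`. -/
instance : Module (NucB f)ᵐᵒᵖ (V f) where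
  smul b x := rightMul x (unop b)
  one_smul x := by
    change toV (rep x * 1) = x
    rw [mul_one, toV_rep]
  mul_smul b c x := by
    change toV (rep x * ((unop c : NucB f).1 * (unop b : NucB f).1)) =
      toV (rep (toV (rep x * (unop c : NucB f).1)) * (unop b : NucB f).1)
    rw [rep_toV, (unop b).2]
  smul_zero b := by
    change toV (rep 0 * (unop b : NucB f).1) = 0
    rw [rep_zero, zero_mul]; rfl
  smul_add b x y := by
    change toV (rep (x + y) * (unop b : NucB f).1) = _
    rw [rep_add, add_mul, toV_add]; rfl
  add_smul b c x := by
    change toV (rep x * ((unop b : NucB f).1 + (unop c : NucB f).1)) = _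
    rw [mul_add, toV_add]; rfl
  zero_smul x := by
    change toV (rep x * 0) = 0
    rw [mul_zero]; rfl

theorem op_smul_def (b : NucB f) (x : V f) : op b • x = rightMul x b := rfl

end RightModule

end Petit

/-! ### Generalized rank metric codes -/

section Codes

/-- The column rank of a matrix over a division ring `B`: the rank of the right `B`-module
generated by its columns. -/
def colRank {ι B : Type*} [Ring B] (M : Matrix ι ι B) : ℕ :=
  Module.finrank Bᵐᵒᵖ (Submodule.span Bᵐᵒᵖ (Set.range fun j : ι => fun i : ι => M i j))

/-- `𝒞 ⊆ M_ι(B)` has minimum distance `δ`. -/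
def HasMinDist {ι B : Type*} [Ring B] (𝒞 : Set (Matrix ι ι B)) (δ : ℕ) : Prop :=
  IsLeast {r | ∃ M ∈ 𝒞, ∃ N ∈ 𝒞, M ≠ N ∧ r = colRank (M - N)} δ

/-- `𝒞 ⊆ M_ι(B)`, with `k = |ι|`, is an `L`-linear generalized MRD code over the division algebra
`B` with minimum distance `δ`: it is an `L`-subspace whose dimension attains the Singleton-like
bound `dim_L 𝒞 = k (k - δ + 1) [B : L]`, all dimensions being finite. -/
structure IsGenMRDCode (L : Type*) [Field L] {ι B : Type*} [Fintype ι] [Ring B] [Module L B]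
    (𝒞 : Set (Matrix ι ι B)) (δ : ℕ) : Prop where
  nontrivial : Nontrivial B
  isUnit_of_ne_zero : ∀ b : B, b ≠ 0 → IsUnit b
  finite : Module.Finite L B
  minDist : HasMinDist 𝒞 δ
  dist_le : δ ≤ Fintype.card ι
  linear : ∃ W : Submodule L (Matrix ι ι B), (W : Set (Matrix ι ι B)) = 𝒞 ∧
    Module.finrank L W = Fintype.card ι * (Fintype.card ι - δ + 1) * Module.finrank L B

end Codes

/-! ### The construction -/

section Construction

variable {D : Type*} [DivisionRing D] [MulSemiringAction (Multiplicative ℕ) D]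

/-- `p` is similar to `q`: `R / R p ≅ R / R q` as left `R`-modules. -/
def Similar (p q : SkewPolynomial D) : Prop := Nonempty (V p ≃ₗ[SkewPolynomial D] V q)

/-- All irreducible factors of `g` are similar to `f`. -/
def AllIrreducibleFactorsSimilar (g f : SkewPolynomial D) : Prop :=
  ∀ p, Irreducible p → (∃ a b, g = a * p * b) → Similar p f

/-- `(f, g)_r = 1`: every common right divisor of `f` and `g` is a unit. -/
def RightCoprime (f g : SkewPolynomial D) : Prop :=
  ∀ p, (∃ a, f = a * p) → (∃ b, g = b * p) → IsUnit p

/-- `f` is right-invariant: the left ideal `R f` is two-sided. -/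
def RightInvariant (f : SkewPolynomial D) : Prop :=
  ∀ g, f * g ∈ Ideal.span {f}

/-- `h` is a product of `k` irreducible factors. -/
def HasNumFactors (h : SkewPolynomial D) (k : ℕ) : Prop :=
  ∃ P : List (SkewPolynomial D), (∀ p ∈ P, Irreducible p) ∧ P.prod = h ∧ P.length = k

/-- The central element `ĝ(u⁻¹ tⁿ)` of `R`, for `ĝ ∈ F[x]`. -/
def centralEval (u : D) (n : ℕ) (g : (FieldF D)[X]) : SkewPolynomial D :=
  Polynomial.aeval (C u⁻¹ * X ^ n : SkewPolynomial D) g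

/-- `h(t) = ĥ(u⁻¹ tⁿ)` is the minimal central left multiple of `f`: `ĥ ∈ F[x]` is monic, `h ∈ R f`,
and `h` has minimal degree among the nonzero elements of `F[u⁻¹ tⁿ] ∩ R f`. -/
structure IsMinCentralLeftMultiple (u : D) (n : ℕ) (f : SkewPolynomial D)
    (hhat : (FieldF D)[X]) : Prop where
  monic : hhat.Monic
  mem : ∃ g, centralEval u n hhat = g * f
  minimal : ∀ q : (FieldF D)[X], q ≠ 0 → (∃ g, centralEval u n q = g * f) →
    natDegree (centralEval u n hhat) ≤ natDegree (centralEval u n q)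

/-- The set `A` of all `d₀ + d₁ t + ⋯ + d_{N-1} t^{N-1} + ν ρ(d₀) t^N` with `dᵢ ∈ D`. -/
def setA (ν : D) (ρ : D ≃+* D) (N : ℕ) : Set (SkewPolynomial D) :=
  {a | ∃ d : ℕ → D, a = (∑ i ∈ Finset.range N, C (d i) * X ^ i) + C (ν * ρ (d 0)) * X ^ N}

/-- The set `S = {a + R h | a ∈ A} ⊆ R / R h`, where `A` is formed with `N = l m`. -/
def setS (ν : D) (ρ : D ≃+* D) (N : ℕ) (h : SkewPolynomial D) :
    Set (SkewPolynomial D ⧸ Ideal.span {h}) :=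
  Submodule.Quotient.mk '' setA ν ρ N

/-- The matrix `M_a` over `B` of the left multiplication `L_a : V_f → V_f`, `x ↦ a x`, with respect
to a right `B`-basis `v` of `V_f`: `a v_j = ∑ i, v_i (M_a)_{ij}`. -/
def leftMulMatrix {f : SkewPolynomial D} {ι : Type*} (v : Module.Basis ι (NucB f)ᵐᵒᵖ (V f))
    (a : SkewPolynomial D) : Matrix ι ι (NucB f) :=
  fun i j => unop (v.repr (a • v j) i)

/-- The code `𝒞(S) = {M_a | a + R h ∈ S}` in `M_ι(B)`. -/
def code {f : SkewPolynomial D} {ι : Type*} (v : Module.Basis ι (NucB f)ᵐᵒᵖ (V f))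
    (h : SkewPolynomial D) (S : Set (SkewPolynomial D ⧸ Ideal.span {h})) :
    Set (Matrix ι ι (NucB f)) :=
  {M | ∃ a : SkewPolynomial D, (Submodule.Quotient.mk a : SkewPolynomial D ⧸ Ideal.span {h}) ∈ S ∧
    M = leftMulMatrix v a}

end Construction

end SkewMRD

end

/-! Write `m = deg f` and `V = R/Rf`. Right division makes `R` a domain whose left ideals are
principal, so `V` is simple for irreducible `f`. By `mem_rightNucleus_iff`, `B` is the eigenspace of
all `b` with `fb ∈ Rf`; acting on the right, it gives exactly the `R`-endomorphisms of `V`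
(`exists_eq_op_smul`). Schur's lemma makes `B` a division ring, and Jacobson density
(`exists_smul_eq`) says that `R` moves `B`-independent vectors of `V` to arbitrary positions.

Consequently, if `Rg` is the left ideal killing `j` independent vectors, evaluation at them gives
`R/Rg ≅ V^j` (`quotEquivPi`), hence `deg g = jm` when `g ≠ 0`. For a basis of `V` this ideal is the
annihilator of `V`, which is `Rh` by `annihilator_V_eq_span`: a two-sided ideal with a monic
generator of nonzero constant term is generated by a polynomial in `u⁻¹tⁿ` over `F`. Comparing
lengths gives `dim_B V = k`; comparing dimensions gives `deg h = km`.

The distance bound follows from `natDegree_eq_and_similar_of_le_finrank_ker`. If a nonzero `a ∈ A`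
kills `l` independent vectors, then `a` is a left multiple of some `g` of degree `lm`; since `deg a
≤ lm`, it is a unit times `g`. So `R/Ra ≅ V^l` and all irreducible factors of `a` are similar to
`f`, which is excluded. Every nonzero `a ∈ A` thus has nullity below `l` and rank at least `k-l+1`.
Equality occurs because vanishing at `l-1` vectors imposes `(l-1)m[D:F']` linear conditions on the
`lm[D:F']`-dimensional space `A`. The Singleton-like bound is attained since `k[B:F'] = m[D:F']`.

If `deg h = dmn`, then `k = dn` and `deg ĥ = dm`. Artin's bound `[C:F] ≤ n` gives `[B:F] ≤ dm`,
while `F[x]/(ĥ)` embeds in `B`, so the two coincide. The code is then transported by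
`IsGenMRDCode.map`. -/

noncomputable section

namespace SkewMRD

open SkewPolynomial MulOpposite

/-! ### Degrees, left ideals and simplicity of `R/Rf`. -/

section Basic

variable {D : Type*} [DivisionRing D]

theorem natDegree_le {p : SkewPolynomial D} {N : ℕ} (h : ∀ i, N < i → coeff p i = 0) :
    natDegree p ≤ N :=
  Finset.sup_le fun i hi => by
    by_contra hlt
    exact mem_support_iff.1 hi (h i (not_le.1 hlt))

theorem le_natDegree {p : SkewPolynomial D} {i : ℕ} (h : coeff p i ≠ 0) : i ≤ natDegree p :=
  Finset.le_sup (f := id) (mem_support_iff.2 h)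

theorem natDegree_monomial {N : ℕ} {c : D} (hc : c ≠ 0) : natDegree (monomial N c) = N := by
  simp [natDegree, support_monomial N hc]

theorem eq_C_of_natDegree_eq_zero {p : SkewPolynomial D} (h : natDegree p = 0) :
    p = C (coeff p 0) := by
  ext i
  rcases Nat.eq_zero_or_pos i with rfl | hi
  · simp
  · rw [coeff_eq_zero_of_lt (by omega), coeff_C_ne_zero hi.ne']

theorem coeff_sum {ι : Type*} (s : Finset ι) (p : ι → SkewPolynomial D) (i : ℕ) :
    coeff (∑ j ∈ s, p j) i = ∑ j ∈ s, coeff (p j) i :=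
  map_sum (AddMonoidHom.mk' (fun g : SkewPolynomial D => coeff g i) fun _ _ => coeff_add _ _ _) p s

variable [MulSemiringAction (Multiplicative ℕ) D]

theorem coeff_mul_natDegree (p q : SkewPolynomial D) :
    coeff (p * q) (natDegree p + natDegree q) =
      coeff p (natDegree p) * φ^[natDegree p] (coeff q (natDegree q)) :=
  coeff_mul_top (fun _ => coeff_eq_zero_of_lt) (fun _ => coeff_eq_zero_of_lt)

theorem coeff_mul_natDegree_ne_zero {p q : SkewPolynomial D} (hp : p ≠ 0) (hq : q ≠ 0) :
    coeff (p * q) (natDegree p + natDegree q) ≠ 0 := by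
  rw [coeff_mul_natDegree]
  exact mul_ne_zero (coeff_natDegree_ne_zero hp)
    (fun h => coeff_natDegree_ne_zero hq (iterate_eq_zero.1 h))

instance : NoZeroDivisors (SkewPolynomial D) where
  eq_zero_or_eq_zero_of_mul_eq_zero {p q} h := by
    by_contra! hne
    exact coeff_mul_natDegree_ne_zero hne.1 hne.2 (by rw [h, coeff_zero])

instance : IsDomain (SkewPolynomial D) := NoZeroDivisors.to_isDomain _

theorem natDegree_mul {p q : SkewPolynomial D} (hp : p ≠ 0) (hq : q ≠ 0) :
    natDegree (p * q) = natDegree p + natDegree q :=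
  le_antisymm
    (natDegree_le fun _ hi => coeff_mul_above (fun _ => coeff_eq_zero_of_lt)
      (fun _ => coeff_eq_zero_of_lt) hi)
    (le_natDegree (coeff_mul_natDegree_ne_zero hp hq))

theorem isUnit_C {c : D} (hc : c ≠ 0) : IsUnit (C c : SkewPolynomial D) :=
  (IsUnit.mk0 c hc).map (CRingHom : D →+* SkewPolynomial D)

theorem isUnit_of_natDegree_eq_zero {p : SkewPolynomial D} (hp : p ≠ 0) (h : natDegree p = 0) :
    IsUnit p := by
  rw [eq_C_of_natDegree_eq_zero h]
  refine isUnit_C fun h0 => hp ?_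
  rw [eq_C_of_natDegree_eq_zero h, h0, C_0]

theorem coeff_C_mul (c : D) (p : SkewPolynomial D) (i : ℕ) : coeff (C c * p) i = c * coeff p i := by
  have h := coeff_monomial_mul 0 c p i
  rwa [zero_add, monomial_zero_left] at h

theorem natDegree_C_mul {c : D} (hc : c ≠ 0) (p : SkewPolynomial D) :
    natDegree (C c * p) = natDegree p := by
  by_cases hp : p = 0
  · rw [hp, mul_zero]
  rw [natDegree_mul (isUnit_C hc).ne_zero hp, ← monomial_zero_left, natDegree_monomial hc, zero_add]

theorem exists_eq_mul_of_mem_span {g p : SkewPolynomial D} (h : p ∈ Ideal.span {g}) :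
    ∃ q, p = q * g :=
  (Ideal.mem_span_singleton'.1 h).imp fun _ => Eq.symm

theorem mul_mem_span (q g : SkewPolynomial D) : q * g ∈ Ideal.span {g} :=
  Ideal.mul_mem_left _ _ (Ideal.mem_span_singleton_self g)

theorem natDegree_le_of_mem_span {g p : SkewPolynomial D} (h : p ∈ Ideal.span {g}) (hp : p ≠ 0) :
    natDegree g ≤ natDegree p := by
  obtain ⟨q, rfl⟩ := exists_eq_mul_of_mem_span h
  rw [natDegree_mul (left_ne_zero_of_mul hp) (right_ne_zero_of_mul hp)]
  exact Nat.le_add_left _ _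

/-- Every nonzero left ideal of `D[t;σ]` is generated by a monic skew polynomial. -/
theorem exists_monic_eq_span (I : Ideal (SkewPolynomial D)) (hI : I ≠ ⊥) :
    ∃ g : SkewPolynomial D, coeff g (natDegree g) = 1 ∧ I = Ideal.span {g} := by
  classical
  have hex : ∃ N, ∃ p ∈ I, p ≠ 0 ∧ natDegree p = N := by
    obtain ⟨p, hp, hp0⟩ := Submodule.exists_mem_ne_zero_of_ne_bot hI
    exact ⟨_, p, hp, hp0, rfl⟩
  obtain ⟨p, hpI, hp0, hpN⟩ := Nat.find_spec hex
  have hmin : ∀ q ∈ I, q ≠ 0 → natDegree p ≤ natDegree q := fun q hq hq0 => by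
    rw [hpN]
    exact Nat.find_min' hex ⟨q, hq, hq0, rfl⟩
  have hc := inv_ne_zero (coeff_natDegree_ne_zero hp0)
  have hdeg := natDegree_C_mul hc p
  refine ⟨C (coeff p (natDegree p))⁻¹ * p, ?_, le_antisymm (fun q hq => ?_) ?_⟩
  · rw [hdeg, coeff_C_mul, inv_mul_cancel₀ (coeff_natDegree_ne_zero hp0)]
  · set g := C (coeff p (natDegree p))⁻¹ * p with hg
    have hgI : g ∈ I := I.mul_mem_left _ hpI
    have hg0 : g ≠ 0 := mul_ne_zero (isUnit_C hc).ne_zero hp0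
    have hr : modR g q ∈ I := by
      have := I.sub_mem hq ((Ideal.span_singleton_le_iff_mem I).2 hgI (sub_modR_mem g q))
      rwa [sub_sub_cancel] at this
    have : modR g q = 0 := by
      by_contra hne
      have h1 := hmin _ hr hne
      rw [← hdeg] at h1
      exact coeff_natDegree_ne_zero hne (modR_mem g q hg0 _ h1)
    simpa [this] using sub_modR_mem g q
  · rw [Ideal.span_singleton_le_iff_mem]
    exact I.mul_mem_left _ hpI

theorem span_eq_top_of_isUnit {p : SkewPolynomial D} (hp : IsUnit p) :
    Ideal.span {p} = (⊤ : Ideal (SkewPolynomial D)) :=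
  Ideal.eq_top_of_isUnit_mem _ (Ideal.mem_span_singleton_self p) hp

theorem isUnit_of_span_eq_top {p : SkewPolynomial D} (h : Ideal.span {p} = ⊤) : IsUnit p := by
  obtain ⟨q, hq⟩ := exists_eq_mul_of_mem_span (h ▸ Submodule.mem_top : (1 : SkewPolynomial D) ∈ _)
  -- In a domain a left inverse is also a right inverse.
  exact IsUnit.of_mul_eq_one q (mul_eq_one_symm hq.symm)

/-- The module `R / R f` is simple for irreducible `f`. -/
theorem isSimpleModule_V {f : SkewPolynomial D} (hf : Irreducible f) :
    IsSimpleModule (SkewPolynomial D) (V f) := by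
  refine isSimpleModule_iff_isCoatom.2 ⟨fun h => hf.not_isUnit (isUnit_of_span_eq_top h), ?_⟩
  intro I hI
  obtain ⟨g, -, rfl⟩ := exists_monic_eq_span I (ne_bot_of_gt hI)
  obtain ⟨q, hq⟩ := exists_eq_mul_of_mem_span (hI.le (Ideal.mem_span_singleton_self f))
  rcases hf.isUnit_or_isUnit hq with h | h
  · obtain ⟨w, rfl⟩ := h
    refine absurd hI (not_lt_of_ge ?_)
    change Ideal.span {g} ≤ Ideal.span {f}
    rw [Ideal.span_singleton_le_iff_mem]
    have : g = (↑w⁻¹ : SkewPolynomial D) * f := by rw [hq, Units.inv_mul_cancel_left]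
    rw [this]
    exact mul_mem_span _ _
  · exact span_eq_top_of_isUnit h

end Basic

/-! ### Dimension of `R/Rf` over a central subfield fixed by `σ`. -/

section Dimension

variable {D : Type*} [DivisionRing D] [MulSemiringAction (Multiplicative ℕ) D]
variable {K : Type*} [Field K] [Algebra K D] [SMulCommClass (Multiplicative ℕ) K D]

variable (K) in
/-- The coefficients of a skew polynomial of degree less than `deg f`. -/
def reducedEquiv {f : SkewPolynomial D} (hf : f ≠ 0) :
    reduced f ≃ₗ[K] (Fin (natDegree f) → D) where
  toFun g i := coeff g.1 i
  map_add' g g' := by ext i; exact coeff_add _ _ _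
  map_smul' c g := rfl
  invFun d := ⟨∑ i : Fin (natDegree f), monomial i (d i), by
    refine sum_mem fun i _ _ j hj => ?_
    rw [coeff_monomial, if_neg (by omega)]⟩
  left_inv g := by
    refine Subtype.ext (SkewPolynomial.ext fun j => ?_)
    change coeff (∑ i : Fin (natDegree f), monomial i.1 (coeff g.1 i)) j = coeff g.1 j
    rw [coeff_sum]
    by_cases hj : j < natDegree f
    · rw [Finset.sum_eq_single ⟨j, hj⟩ (fun b _ hb => ?_) (by simp), coeff_monomial, if_pos rfl]
      rw [coeff_monomial, if_neg fun h => hb (Fin.ext h)]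
    · rw [g.2 hf j (not_lt.1 hj)]
      exact Finset.sum_eq_zero fun b _ => by rw [coeff_monomial, if_neg (by omega)]
  right_inv d := by
    ext j
    change coeff (∑ i : Fin (natDegree f), monomial i.1 (d i)) j = d j
    rw [coeff_sum, Finset.sum_eq_single j (fun b _ hb => ?_) (by simp), coeff_monomial, if_pos rfl]
    rw [coeff_monomial, if_neg fun h => hb (Fin.ext h)]

variable (K) in
/-- `R_m ≃ R / R f`. -/
def reducedEquivV (f : SkewPolynomial D) : reduced f ≃ₗ[K] V f :=
  LinearEquiv.ofBijective (M := reduced f) (M₂ := V f)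
    { toFun := fun g => (Submodule.Quotient.mk g.1 : V f)
      map_add' := fun _ _ => rfl
      map_smul' := fun _ _ => rfl }
    ⟨fun x y h => Subtype.ext (eq_of_mem_reduced x.2 y.2 ((Submodule.Quotient.eq _).1 h)),
      fun x => ⟨(rep x : PetitAlgebra f), toV_rep x⟩⟩

variable (K) in
theorem finite_V [Module.Finite K D] {f : SkewPolynomial D} (hf : f ≠ 0) : Module.Finite K (V f) :=
  Module.Finite.equiv ((reducedEquiv K hf).symm.trans (reducedEquivV K f))

variable (K) in
theorem finrank_V [Module.Finite K D] {f : SkewPolynomial D} (hf : f ≠ 0) :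
    Module.finrank K (V f) = natDegree f * Module.finrank K D := by
  rw [← ((reducedEquiv K hf).symm.trans (reducedEquivV K f)).finrank_eq, Module.finrank_pi_fintype]
  simp

end Dimension

/-! ### Jacobson density. -/

section Density

/-- Jacobson density for a module over a ring with a division ring of commuting operators that
realizes all endomorphisms: linearly independent vectors can be moved to any position. -/
theorem exists_smul_eq_of_linearIndependent {R E M : Type*} [Ring R] [DivisionRing E]
    [AddCommGroup M] [Module R M] [Module E M] [IsSemisimpleModule R M]
    (hE : ∀ φ : Module.End R M, ∃ b : E, ∀ x, φ x = b • x) {ι : Type*} [Finite ι] {v : ι → M}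
    (hv : LinearIndependent E v) (w : ι → M) : ∃ r : R, ∀ i, r • v i = w i := by
  classical
  have := Fintype.ofFinite ι
  obtain ⟨T, hT⟩ : ∃ T : M →ₗ[E] M, ∀ i, T (v i) = w i := by
    obtain ⟨T, hT⟩ := LinearMap.exists_extend ((Module.Basis.span hv).constr ℕ w)
    refine ⟨T, fun i => ?_⟩
    have h1 := LinearMap.congr_fun hT (Module.Basis.span hv i)
    rw [Module.Basis.constr_basis] at h1
    rw [← h1, LinearMap.comp_apply, Submodule.subtype_apply, Module.Basis.span_apply]
  -- An `E`-linear map commutes with all `R`-endomorphisms, because each of these acts as a scalar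
  -- from `E`. Hence density applies to it.
  let T' : Module.End (Module.End R M) M :=
    { toFun := T
      map_add' := map_add T
      map_smul' := fun φ x => by
        obtain ⟨b, hb⟩ := hE φ
        change T (φ x) = φ (T x)
        rw [hb, hb, map_smul] }
  obtain ⟨r, hr⟩ := jacobson_density T' (Finset.univ.image v)
  exact ⟨r, fun i => by
    rw [← hr _ (Finset.mem_image_of_mem _ (Finset.mem_univ i))]
    exact hT i⟩

end Density

/-! ### The right nucleus as endomorphism ring of `R/Rf`. -/

section Nuc

variable {D : Type*} [DivisionRing D] [MulSemiringAction (Multiplicative ℕ) D]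
variable {f : SkewPolynomial D}

theorem mk_eq_mk_iff {g g' : SkewPolynomial D} :
    PetitAlgebra.mk f g = PetitAlgebra.mk f g' ↔ g - g' ∈ Ideal.span {f} := by
  refine ⟨fun h => ?_, PetitAlgebra.mk_congr⟩
  have h1 : modR f g = modR f g' := congrArg PetitAlgebra.val h
  have h2 := sub_mem (sub_modR_mem f g) (sub_modR_mem f g')
  rwa [h1, sub_sub_sub_cancel_right] at h2

theorem mul_mem_span_of_mem {b : SkewPolynomial D} (hb : f * b ∈ Ideal.span {f})
    {g : SkewPolynomial D} (hg : g ∈ Ideal.span {f}) : g * b ∈ Ideal.span {f} := by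
  obtain ⟨q, rfl⟩ := exists_eq_mul_of_mem_span hg
  rw [mul_assoc]
  exact Ideal.mul_mem_left _ _ hb

/-- The right nucleus of `S_f` is the eigenspace `{b | f b ∈ R f}` of `f`. -/
theorem mem_rightNucleus_iff (hm : 1 < natDegree f) (hf : coeff f (natDegree f) = 1)
    {b : PetitAlgebra f} : b ∈ rightNucleus (PetitAlgebra f) ↔ f * b.val ∈ Ideal.span {f} := by
  have hl : ∀ x y : PetitAlgebra f, x * y * b = PetitAlgebra.mk f (modR f (x.val * y.val) * b.val) :=
    fun _ _ => rfl
  have hr : ∀ x y : PetitAlgebra f, x * (y * b) = PetitAlgebra.mk f (x.val * (y.val * b.val)) :=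
    fun x y => by
      refine (mk_eq_mk_iff.2 ?_).symm
      rw [← mul_sub]
      exact Ideal.mul_mem_left _ _ (sub_modR_mem f _)
  constructor
  · intro h
    have hX : X ∈ reduced f := fun _ i hi => by rw [coeff_X, if_neg (by omega)]
    have hXm : (X ^ (natDegree f - 1) : SkewPolynomial D) ∈ reduced f := fun _ i hi => by
      rw [X_pow_eq_monomial, coeff_monomial, if_neg (by omega)]
    -- The associator of `t`, `t^(m-1)` and `b` suffices: `t · t^(m-1)` has remainder `t^m - f`, so
    -- the associator is the class of `-fb`. Here `m > 1` makes `t` itself reduced.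
    obtain ⟨x, hx⟩ : ∃ x : PetitAlgebra f, x.val = X := ⟨⟨X, hX⟩, rfl⟩
    obtain ⟨y, hy⟩ : ∃ y : PetitAlgebra f, y.val = X ^ (natDegree f - 1) := ⟨⟨_, hXm⟩, rfl⟩
    have h1 := h x y
    rw [hl, hr, mk_eq_mk_iff, hx, hy, ← mul_assoc, ← pow_succ', Nat.sub_add_cancel hm.le] at h1
    have h2 : modR f (X ^ natDegree f) = X ^ natDegree f - f := by
      refine modR_eq (fun _ i hi => ?_) ?_
      · rw [coeff_sub, X_pow_eq_monomial, coeff_monomial]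
        rcases hi.eq_or_lt with rfl | hi
        · rw [if_pos rfl, hf, sub_self]
        · rw [if_neg hi.ne, coeff_eq_zero_of_lt hi, sub_self]
      · rw [sub_sub_cancel]
        exact Ideal.mem_span_singleton_self f
    rw [h2, ← sub_mul, sub_sub_cancel_left, neg_mul] at h1
    exact neg_mem_iff.1 h1
  · intro h x y
    rw [hl, hr, mk_eq_mk_iff, ← mul_assoc, ← sub_mul, ← neg_sub, neg_mul]
    exact neg_mem (mul_mem_span_of_mem h (sub_modR_mem f _))

theorem mul_val_mem_span (hm : 1 < natDegree f) (hf : coeff f (natDegree f) = 1) (b : NucB f) :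
    f * b.1.val ∈ Ideal.span {f} :=
  (mem_rightNucleus_iff hm hf).1 b.2

/-- As `fb ∈ Rf`, right multiplication by `b` preserves `Rf`, so the action may be computed on any
representative. This makes the left `R`-action and the right `B`-action commute. -/
theorem op_smul_mk (hm : 1 < natDegree f) (hf : coeff f (natDegree f) = 1)
    (b : (NucB f)ᵐᵒᵖ) (g : SkewPolynomial D) :
    b • (Submodule.Quotient.mk g : V f) = Submodule.Quotient.mk (g * (unop b).1.val) := by
  refine (Submodule.Quotient.eq _).2 ?_
  change modR f (modR f g * (unop b).1.val) - g * (unop b).1.val ∈ Ideal.span {f}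
  have h1 := mul_mem_span_of_mem (mul_val_mem_span hm hf (unop b)) (sub_modR_mem f g)
  rw [sub_mul] at h1
  have h2 := neg_mem (add_mem h1 (sub_modR_mem f (modR f g * (unop b).1.val)))
  rwa [sub_add_sub_cancel, neg_sub] at h2

theorem smulCommClass_V (hm : 1 < natDegree f) (hf : coeff f (natDegree f) = 1) :
    SMulCommClass (NucB f)ᵐᵒᵖ (SkewPolynomial D) (V f) where
  smul_comm b r x := by
    obtain ⟨g, rfl⟩ := Submodule.Quotient.mk_surjective _ x
    rw [op_smul_mk hm hf, ← Submodule.Quotient.mk_smul, ← Submodule.Quotient.mk_smul,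
      op_smul_mk hm hf, smul_eq_mul, smul_eq_mul, mul_assoc]

theorem isScalarTower_V (hm : 1 < natDegree f) (hf : coeff f (natDegree f) = 1)
    (K : Type*) [Field K] [Algebra K D] [SMulCommClass (Multiplicative ℕ) K D] :
    IsScalarTower K (NucB f)ᵐᵒᵖ (V f) where
  smul_assoc c b x := by
    obtain ⟨g, rfl⟩ := Submodule.Quotient.mk_surjective _ x
    rw [op_smul_mk hm hf, op_smul_mk hm hf, ← Submodule.Quotient.mk_smul]
    congr 1
    exact mul_smul_comm c g _

/-- Every `R`-linear endomorphism of `V_f` is the right multiplication by an element of `B`. -/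
theorem exists_eq_op_smul (hm : 1 < natDegree f) (hf : coeff f (natDegree f) = 1)
    (φ : Module.End (SkewPolynomial D) (V f)) : ∃ b : (NucB f)ᵐᵒᵖ, ∀ x, φ x = b • x := by
  -- The endomorphism is determined by the image `w` of the generator `1`, and being well defined on
  -- `R/Rf` it forces `fw ∈ Rf`.
  obtain ⟨w, hw⟩ := Submodule.Quotient.mk_surjective _ (φ (Submodule.Quotient.mk 1))
  have hmk : ∀ g : SkewPolynomial D, φ (Submodule.Quotient.mk g) = Submodule.Quotient.mk (g * w) := by
    intro g
    have h1 : (Submodule.Quotient.mk g : V f) = g • Submodule.Quotient.mk 1 := by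
      rw [← Submodule.Quotient.mk_smul, smul_eq_mul, mul_one]
    rw [h1, map_smul, ← hw, ← Submodule.Quotient.mk_smul, smul_eq_mul]
  have hfw : f * w ∈ Ideal.span {f} := by
    rw [← Submodule.Quotient.mk_eq_zero, ← hmk,
      (Submodule.Quotient.mk_eq_zero _).2 (Ideal.mem_span_singleton_self f), map_zero]
  have hb : f * (PetitAlgebra.mk f w).val ∈ Ideal.span {f} := by
    have := sub_mem hfw (Ideal.mul_mem_left _ f (sub_modR_mem f w))
    rwa [mul_sub, sub_sub_cancel] at this
  refine ⟨op ⟨PetitAlgebra.mk f w, (mem_rightNucleus_iff hm hf).2 hb⟩, fun x => ?_⟩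
  obtain ⟨g, rfl⟩ := Submodule.Quotient.mk_surjective _ x
  rw [hmk, op_smul_mk hm hf, Submodule.Quotient.eq, ← mul_sub]
  exact Ideal.mul_mem_left _ _ (sub_modR_mem f w)

theorem nontrivial_NucB (hm : 1 < natDegree f) : Nontrivial (NucB f) := by
  refine ⟨0, 1, fun h => ?_⟩
  have h1 : PetitAlgebra.mk f 0 = PetitAlgebra.mk f 1 := by
    rw [PetitAlgebra.mk_zero]
    exact congrArg Subtype.val h
  have h2 := sub_mem (mk_eq_mk_iff.1 h1) (zero_mem _)
  rw [zero_sub, sub_zero, neg_mem_iff] at h2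
  have h3 := natDegree_le_of_mem_span h2 one_ne_zero
  rw [← monomial_zero_one, natDegree_monomial one_ne_zero] at h3
  omega

/-- Schur's lemma: `Bᵐᵒᵖ` is isomorphic to the endomorphism ring of a simple module. Injectivity
holds because acting on the class of `1` recovers `b`. -/
theorem isUnit_NucB (hm : 1 < natDegree f) (hf : coeff f (natDegree f) = 1) (hirr : Irreducible f)
    (b : NucB f) (hb : b ≠ 0) : IsUnit b := by
  classical
  have := smulCommClass_V hm hf
  have := isSimpleModule_V hirr
  let T : (NucB f)ᵐᵒᵖ →+* Module.End (SkewPolynomial D) (V f) := Module.toModuleEnd _ _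
  have hinj : Function.Injective T := by
    refine (injective_iff_map_eq_zero T).2 fun a ha => ?_
    have h1 : a • (Submodule.Quotient.mk 1 : V f) = 0 := LinearMap.congr_fun ha _
    rw [op_smul_mk hm hf, one_mul, Submodule.Quotient.mk_eq_zero] at h1
    refine unop_injective (Subtype.ext ?_)
    rw [← PetitAlgebra.mk_val (unop a).1, (mk_eq_mk_iff (g' := 0)).2 (by rwa [sub_zero]), PetitAlgebra.mk_zero]
    rfl
  have hsurj : Function.Surjective T := fun φ => by
    obtain ⟨b, hb⟩ := exists_eq_op_smul hm hf φ
    exact ⟨b, LinearMap.ext fun x => (hb x).symm⟩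
  let e := RingEquiv.ofBijective T ⟨hinj, hsurj⟩
  have h1 : IsUnit (e (op b)) :=
    IsUnit.mk0 _ fun h => hb (op_injective ((map_eq_zero_iff e e.injective).1 h))
  exact isUnit_op.1 ((isUnit_map_iff e _).1 h1)

/-- The division ring structure on the opposite of `B`. -/
abbrev divisionRingOp (hm : 1 < natDegree f) (hf : coeff f (natDegree f) = 1)
    (hirr : Irreducible f) : DivisionRing (NucB f)ᵐᵒᵖ :=
  haveI := nontrivial_NucB hm
  DivisionRing.ofIsUnitOrEqZero fun b => (em (b = 0)).symm.imp_left fun h =>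
    isUnit_unop.1 (isUnit_NucB hm hf hirr (unop b) fun h0 => h (unop_injective h0))

theorem exists_smul_eq (hm : 1 < natDegree f) (hf : coeff f (natDegree f) = 1)
    (hirr : Irreducible f) {ι : Type*} [Finite ι] {v : ι → V f}
    (hv : LinearIndependent (NucB f)ᵐᵒᵖ v) (w : ι → V f) :
    ∃ r : SkewPolynomial D, ∀ i, r • v i = w i := by
  let := divisionRingOp hm hf hirr
  have := isSimpleModule_V hirr
  exact exists_smul_eq_of_linearIndependent (exists_eq_op_smul hm hf) hv w

end Nuc

/-! ### Multiplication by constants and by `t`. -/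

section Coefficients

variable {D : Type*} [DivisionRing D]

theorem eq_sum_monomial (p : SkewPolynomial D) :
    p = ∑ j ∈ p.support, monomial j (coeff p j) := by
  conv_lhs => rw [← sum_monomial p, sum_def]

variable [MulSemiringAction (Multiplicative ℕ) D]

theorem coeff_mul_C (p : SkewPolynomial D) (a : D) (i : ℕ) :
    coeff (p * C a) i = coeff p i * φ^[i] a := by
  rw [coeff_mul_eq_sum, Finset.sum_eq_single i]
  · rw [monomial_mul_C, coeff_monomial, if_pos rfl]
  · intro j _ hj
    rw [monomial_mul_C, coeff_monomial, if_neg hj]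
  · intro h
    rw [notMem_support_iff.1 h, monomial_zero_right, zero_mul, coeff_zero]

theorem coeff_mul_X (p : SkewPolynomial D) (i : ℕ) : coeff (p * X) (i + 1) = coeff p i := by
  rw [coeff_mul_eq_sum, Finset.sum_eq_single i]
  · rw [monomial_mul_X, coeff_monomial, if_pos rfl]
  · intro j _ hj
    rw [monomial_mul_X, coeff_monomial, if_neg (by omega)]
  · intro h
    rw [notMem_support_iff.1 h, monomial_zero_right, zero_mul, coeff_zero]

theorem coeff_mul_X_zero (p : SkewPolynomial D) : coeff (p * X) 0 = 0 := by
  rw [coeff_mul_eq_sum]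
  exact Finset.sum_eq_zero fun j _ => by rw [monomial_mul_X, coeff_monomial_succ]

theorem coeff_X_mul (p : SkewPolynomial D) (i : ℕ) : coeff (X * p) (i + 1) = φ (coeff p i) := by
  have h := coeff_monomial_mul 1 1 p i
  rwa [one_mul, add_comm] at h

theorem coeff_X_mul_zero (p : SkewPolynomial D) : coeff (X * p) 0 = 0 := by
  rw [X_mul, coeff_mul_X_zero]

theorem exists_eq_mul_X {p : SkewPolynomial D} (h : coeff p 0 = 0) : ∃ q, p = q * X := by
  have hX : natDegree (X : SkewPolynomial D) = 1 := natDegree_monomial one_ne_zero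
  have hX0 : (X : SkewPolynomial D) ≠ 0 := fun h0 => by
    have := coeff_X_one (R := D)
    rw [h0, coeff_zero] at this
    exact zero_ne_one this
  obtain ⟨q, hq⟩ := exists_eq_mul_of_mem_span (sub_modR_mem X p)
  refine ⟨q, ?_⟩
  rw [← hq, eq_comm, sub_eq_self]
  ext i
  rcases Nat.eq_zero_or_pos i with rfl | hi
  · have h0 := coeff_mul_X_zero q
    rw [← hq, coeff_sub, h, zero_sub, neg_eq_zero] at h0
    rw [h0, coeff_zero]
  · exact modR_mem X p hX0 i (by omega)

/-- Needed to see that `tV` is a submodule; surjectivity of `σ` allows the coefficients to be pulled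
back through `t`. -/
theorem exists_mul_X_eq_X_mul (hφ : Function.Surjective (φ : D → D)) (p : SkewPolynomial D) :
    ∃ q, p * X = X * q := by
  choose ψ hψ using hφ
  refine ⟨∑ j ∈ p.support, monomial j (ψ (coeff p j)), ?_⟩
  conv_lhs => rw [eq_sum_monomial p]
  rw [Finset.sum_mul, Finset.mul_sum]
  exact Finset.sum_congr rfl fun j _ => by rw [monomial_mul_X, X_mul_monomial, hψ]

end Coefficients

/-! ### Commutation rules for generators of two-sided ideals. -/

section TwoSided

variable {D : Type*} [DivisionRing D] [MulSemiringAction (Multiplicative ℕ) D]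
variable {g : SkewPolynomial D}

/-- The difference of the two sides lies in `Rg`, but its coefficient in degree `deg g` cancels and
it has none above, so it vanishes. -/
theorem mul_C_eq_of_twoSided (hg : coeff g (natDegree g) = 1)
    (h2 : ∀ r, g * r ∈ Ideal.span {g}) (a : D) : g * C a = C (φ^[natDegree g] a) * g := by
  rw [← sub_eq_zero]
  by_contra hne
  have h1 := natDegree_le_of_mem_span (sub_mem (h2 (C a)) (mul_mem_span _ g)) hne
  refine coeff_natDegree_ne_zero hne ?_
  rw [coeff_sub, coeff_mul_C, coeff_C_mul]
  rcases h1.eq_or_lt with h | h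
  · rw [← h, hg, one_mul, mul_one, sub_self]
  · rw [coeff_eq_zero_of_lt h, zero_mul, mul_zero, sub_self]

/-- The leading terms of `gt` and `tg` cancel, so `gt - tg = qg` with `q` constant. The constant
term of the left side is zero while that of `g` is not, so `q = 0`. -/
theorem mul_X_eq_of_twoSided (hg : coeff g (natDegree g) = 1) (hg0 : coeff g 0 ≠ 0)
    (h2 : ∀ r, g * r ∈ Ideal.span {g}) : g * X = X * g := by
  rw [← sub_eq_zero]
  obtain ⟨q, hq⟩ := exists_eq_mul_of_mem_span (sub_mem (h2 X) (mul_mem_span X g))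
  by_contra hne
  rw [hq] at hne
  have hdeg : natDegree (q * g) ≤ natDegree g := by
    rw [← hq]
    refine natDegree_le fun i hi => ?_
    obtain ⟨i, rfl⟩ : ∃ j, i = j + 1 := ⟨i - 1, by omega⟩
    rw [coeff_sub, coeff_mul_X, coeff_X_mul]
    rcases (Nat.lt_succ_iff.1 hi).eq_or_lt with h | h
    · rw [← h, hg, map_one, sub_self]
    · rw [coeff_eq_zero_of_lt h, map_zero, sub_self]
  rw [natDegree_mul (left_ne_zero_of_mul hne) (right_ne_zero_of_mul hne)] at hdeg
  have hqC := eq_C_of_natDegree_eq_zero (p := q) (by omega)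
  have h0 := congrArg (fun p => coeff p 0) hq
  simp only [coeff_sub, coeff_mul_X_zero, coeff_X_mul_zero, sub_self] at h0
  rw [hqC, coeff_C_mul] at h0
  refine left_ne_zero_of_mul hne ?_
  rw [hqC, (mul_eq_zero.1 h0.symm).resolve_right hg0, C_0]

end TwoSided

/-! ### Polynomials in `u⁻¹tⁿ` over `F`. -/

section Central

variable {D : Type*} [DivisionRing D] [MulSemiringAction (Multiplicative ℕ) D]
variable {u : D} {n : ℕ}

theorem iterate_mul_eq_conj (hun : ∀ z : D, φ^[n] z = u * z * u⁻¹) (q : ℕ) (z : D) :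
    φ^[n * q] z = u ^ q * z * (u ^ q)⁻¹ := by
  induction q with
  | zero => simp
  | succ q ih =>
    rw [Nat.mul_succ, add_comm, Function.iterate_add_apply, ih, hun, pow_succ' u q, mul_inv_rev]
    simp only [mul_assoc]

/-- Dividing `i` by `n` and removing the inner part coming from `σⁿ` leaves an inner power of
exponent `i % n < n`, which minimality of `n` forbids unless it is the zeroth. -/
theorem dvd_of_iterate_inner (hn : 0 < n) (hu : u ≠ 0) (hun : ∀ z : D, φ^[n] z = u * z * u⁻¹)
    (hmin : ∀ j, 0 < j → j < n → ¬ ∃ w : D, w ≠ 0 ∧ ∀ z, φ^[j] z = w * z * w⁻¹)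
    {i : ℕ} {w : D} (hw : w ≠ 0) (hi : ∀ z : D, φ^[i] z = w * z * w⁻¹) : n ∣ i := by
  by_contra hdvd
  refine hmin (i % n) (Nat.pos_of_ne_zero fun h => hdvd (Nat.dvd_of_mod_eq_zero h))
    (Nat.mod_lt _ hn) ⟨(u ^ (i / n))⁻¹ * w, mul_ne_zero (inv_ne_zero (pow_ne_zero _ hu)) hw,
      fun z => ?_⟩
  have h1 := hi z
  rw [← Nat.div_add_mod i n, Function.iterate_add_apply, iterate_mul_eq_conj hun] at h1
  have hU : u ^ (i / n) ≠ 0 := pow_ne_zero _ hu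
  rw [mul_inv_rev, inv_inv]
  calc φ^[i % n] z = (u ^ (i / n))⁻¹ * (u ^ (i / n) * φ^[i % n] z * (u ^ (i / n))⁻¹) * u ^ (i / n) := by
        rw [mul_assoc, inv_mul_cancel_right₀ hU, inv_mul_cancel_left₀ hU]
    _ = _ := by rw [h1]; simp only [mul_assoc]

theorem C_inv_mul_X_pow_pow (hun : ∀ z : D, φ^[n] z = u * z * u⁻¹) (hu : u ≠ 0) (j : ℕ) :
    (C u⁻¹ * X ^ n : SkewPolynomial D) ^ j = monomial (n * j) (u ^ j)⁻¹ := by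
  induction j with
  | zero => simp [← C_1]
  | succ j ih =>
    rw [pow_succ, ih, C_mul_X_pow_eq_monomial, monomial_mul_monomial, iterate_mul_eq_conj hun,
      pow_succ' u j, mul_inv_rev, Nat.mul_succ]
    have hc : u ^ j * u⁻¹ = u⁻¹ * u ^ j := ((Commute.refl u).pow_left j).inv_right₀
    rw [hc, mul_inv_cancel_right₀ (pow_ne_zero j hu), ← mul_inv_rev]

theorem centralEval_eq_sum (hun : ∀ z : D, φ^[n] z = u * z * u⁻¹) (hu : u ≠ 0)
    (q : (FieldF D)[X]) :
    centralEval u n q = ∑ j ∈ q.support, monomial (n * j) ((q.coeff j).1 * (u ^ j)⁻¹) := by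
  rw [centralEval, Polynomial.aeval_eq_sum_range' (n := q.natDegree + 1) (by omega)]
  rw [Finset.sum_subset (s₂ := Finset.range (q.natDegree + 1)) Polynomial.supp_subset_range_natDegree_succ]
  · refine Finset.sum_congr rfl fun j _ => ?_
    rw [C_inv_mul_X_pow_pow hun hu, smul_monomial]
    rfl
  · intro j _ hj
    rw [Polynomial.notMem_support_iff.1 hj]
    change monomial (n * j) ((0 : D) * _) = 0
    rw [zero_mul, monomial_zero_right]

theorem coeff_centralEval_mul (hn : 0 < n) (hun : ∀ z : D, φ^[n] z = u * z * u⁻¹) (hu : u ≠ 0)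
    (q : (FieldF D)[X]) (j : ℕ) :
    coeff (centralEval u n q) (n * j) = (q.coeff j).1 * (u ^ j)⁻¹ := by
  rw [centralEval_eq_sum hun hu, coeff_sum, Finset.sum_eq_single j]
  · rw [coeff_monomial, if_pos rfl]
  · intro i _ hi
    rw [coeff_monomial, if_neg fun h => hi (Nat.eq_of_mul_eq_mul_left hn h)]
  · intro h
    rw [coeff_monomial, if_pos rfl, Polynomial.notMem_support_iff.1 h]
    exact zero_mul _

theorem coeff_centralEval_of_not_dvd (hun : ∀ z : D, φ^[n] z = u * z * u⁻¹) (hu : u ≠ 0)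
    (q : (FieldF D)[X]) {i : ℕ} (hi : ¬ n ∣ i) : coeff (centralEval u n q) i = 0 := by
  rw [centralEval_eq_sum hun hu, coeff_sum]
  exact Finset.sum_eq_zero fun j _ => by
    rw [coeff_monomial, if_neg fun h => hi ⟨j, h.symm⟩]

theorem natDegree_centralEval (hn : 0 < n) (hun : ∀ z : D, φ^[n] z = u * z * u⁻¹) (hu : u ≠ 0)
    (q : (FieldF D)[X]) : natDegree (centralEval u n q) = n * q.natDegree := by
  by_cases hq : q = 0
  · rw [hq, centralEval, map_zero]
    simp [natDegree]
  refine le_antisymm (natDegree_le fun i hi => ?_) (le_natDegree ?_)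
  · by_cases hd : n ∣ i
    · obtain ⟨j, rfl⟩ := hd
      rw [coeff_centralEval_mul hn hun hu,
        Polynomial.coeff_eq_zero_of_natDegree_lt (Nat.lt_of_mul_lt_mul_left hi)]
      exact zero_mul _
    · exact coeff_centralEval_of_not_dvd hun hu q hd
  · rw [coeff_centralEval_mul hn hun hu]
    refine mul_ne_zero (fun h => ?_) (inv_ne_zero (pow_ne_zero _ hu))
    exact Polynomial.leadingCoeff_ne_zero.2 hq (Subtype.ext h)

theorem centralEval_ne_zero (hn : 0 < n) (hun : ∀ z : D, φ^[n] z = u * z * u⁻¹) (hu : u ≠ 0)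
    {q : (FieldF D)[X]} (hq : q ≠ 0) : centralEval u n q ≠ 0 := fun h => by
  refine hq (Polynomial.ext fun j => Subtype.ext ?_)
  have h1 := coeff_centralEval_mul hn hun hu q j
  rw [h, coeff_zero, eq_comm, mul_eq_zero] at h1
  exact h1.resolve_right (inv_ne_zero (pow_ne_zero _ hu))

theorem commute_C_inv_mul_X_pow (hun : ∀ z : D, φ^[n] z = u * z * u⁻¹) (hu : u ≠ 0)
    (hφu : φ u = u) (p : SkewPolynomial D) : Commute (C u⁻¹ * X ^ n : SkewPolynomial D) p := by
  rw [eq_sum_monomial p]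
  refine Commute.sum_right _ _ _ fun j _ => ?_
  have hit : φ^[j] u⁻¹ = u⁻¹ := Function.iterate_fixed (by rw [map_inv₀, hφu]) j
  rw [C_mul_X_pow_eq_monomial, Commute, SemiconjBy, monomial_mul_monomial, monomial_mul_monomial,
    hit, hun, add_comm]
  congr 1
  rw [mul_assoc, inv_mul_cancel_left₀ hu]

theorem centralEval_commute (hun : ∀ z : D, φ^[n] z = u * z * u⁻¹) (hu : u ≠ 0)
    (hφu : φ u = u) (q : (FieldF D)[X]) (p : SkewPolynomial D) :
    Commute (centralEval u n q) p := by
  rw [centralEval, Polynomial.aeval_eq_sum_range]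
  exact Commute.sum_left _ _ _ fun j _ =>
    ((commute_C_inv_mul_X_pow hun hu hφu p).pow_left j).smul_left _

/-- A monic skew polynomial with nonzero constant coefficient that generates a two-sided ideal is
central up to a constant from `D`. -/
theorem exists_eq_C_mul_centralEval (hn : 0 < n) (hu : u ≠ 0)
    (hun : ∀ z : D, φ^[n] z = u * z * u⁻¹)
    (hmin : ∀ j, 0 < j → j < n → ¬ ∃ w : D, w ≠ 0 ∧ ∀ z, φ^[j] z = w * z * w⁻¹)
    (hφu : φ u = u) {g : SkewPolynomial D}
    (hg : coeff g (natDegree g) = 1) (hg0 : coeff g 0 ≠ 0)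
    (h2 : ∀ r, g * r ∈ Ideal.span {g}) :
    ∃ (s : ℕ) (q : (FieldF D)[X]), g = C (u ^ s) * centralEval u n q := by
  -- Comparing coefficients in the rules for `ga` and `gt`: at index `0` the power `σ^(deg g)` is
  -- inner, hence so is `σ^i` whenever the `i`-th coefficient is nonzero, and only exponents
  -- divisible by `n` occur.
  have hcoeff : ∀ i a, coeff g i * φ^[i] a = φ^[natDegree g] a * coeff g i := fun i a => by
    rw [← coeff_mul_C, ← coeff_C_mul, mul_C_eq_of_twoSided hg h2]
  have hfix : ∀ i, φ (coeff g i) = coeff g i := fun i => by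
    rw [← coeff_X_mul, ← mul_X_eq_of_twoSided hg hg0 h2, coeff_mul_X]
  have hinner : ∀ a, φ^[natDegree g] a = coeff g 0 * a * (coeff g 0)⁻¹ := fun a => by
    have h1 : coeff g 0 * a = _ := hcoeff 0 a
    rw [h1, mul_inv_cancel_right₀ hg0]
  have hdvd : ∀ i, coeff g i ≠ 0 → n ∣ i := fun i hi => by
    refine dvd_of_iterate_inner hn hu hun hmin (mul_ne_zero (inv_ne_zero hi) hg0) fun a => ?_
    rw [← inv_mul_cancel_left₀ hi (φ^[i] a), hcoeff, hinner, mul_inv_rev, inv_inv]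
    simp only [mul_assoc]
  obtain ⟨s, hs⟩ := hdvd (natDegree g) (by rw [hg]; exact one_ne_zero)
  -- Since `(u⁻¹tⁿ)^j = u^(-j) t^(nj)`, this is the coefficient of `(u⁻¹tⁿ)^j` in `u^(-s) g`, where
  -- `deg g = ns`.
  have hmem : ∀ j, (u ^ s)⁻¹ * coeff g (n * j) * u ^ j ∈ fixedCenter D := fun j => by
    refine ⟨Subring.mem_center_iff.2 fun a => ?_, ?_⟩
    · have h1 := hcoeff (n * j) a
      rw [hs, iterate_mul_eq_conj hun, iterate_mul_eq_conj hun] at h1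
      have hs0 : u ^ s ≠ 0 := pow_ne_zero s hu
      have hj0 : u ^ j ≠ 0 := pow_ne_zero j hu
      calc a * ((u ^ s)⁻¹ * coeff g (n * j) * u ^ j)
          = (u ^ s)⁻¹ * (u ^ s * a * (u ^ s)⁻¹ * coeff g (n * j)) * u ^ j := by
            simp only [mul_assoc, inv_mul_cancel_left₀ hs0]
        _ = _ := by
            rw [← h1]
            simp only [mul_assoc, inv_mul_cancel₀ hj0, mul_one]
    · rw [map_mul, map_mul, map_inv₀, map_pow, map_pow, hφu, hfix]
  obtain ⟨c, hc⟩ : ∃ c : ℕ → FieldF D, ∀ j, (c j).1 = (u ^ s)⁻¹ * coeff g (n * j) * u ^ j :=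
    ⟨fun j => ⟨_, hmem j⟩, fun _ => rfl⟩
  refine ⟨s, ∑ j ∈ Finset.range (s + 1), Polynomial.monomial j (c j), ?_⟩
  ext i
  rw [coeff_C_mul]
  by_cases hi : n ∣ i
  · obtain ⟨j, rfl⟩ := hi
    rw [coeff_centralEval_mul hn hun hu, Polynomial.finsetSum_coeff]
    simp only [Polynomial.coeff_monomial, Finset.sum_ite_eq', Finset.mem_range]
    split_ifs with hj
    · rw [hc, mul_inv_cancel_right₀ (pow_ne_zero j hu), mul_inv_cancel_left₀ (pow_ne_zero s hu)]
    · have : natDegree g < n * j := by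
        rw [hs]
        exact Nat.mul_lt_mul_of_pos_left (by omega) hn
      rw [coeff_eq_zero_of_lt this]
      change 0 = u ^ s * (0 * _)
      rw [zero_mul, mul_zero]
  · rw [coeff_centralEval_of_not_dvd hun hu _ hi, mul_zero]
    by_contra hne
    exact hi (hdvd i hne)

end Central

/-! ### The annihilator of `R/Rf` is `Rh`. -/

section Annihilator

variable {D : Type*} [DivisionRing D] [MulSemiringAction (Multiplicative ℕ) D]
variable {f : SkewPolynomial D}

theorem mem_span_of_mem_annihilator {g : SkewPolynomial D}
    (hg : g ∈ Module.annihilator (SkewPolynomial D) (V f)) : g ∈ Ideal.span {f} := by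
  have h1 := Module.mem_annihilator.1 hg (Submodule.Quotient.mk 1)
  rwa [← Submodule.Quotient.mk_smul, smul_eq_mul, mul_one, Submodule.Quotient.mk_eq_zero] at h1

/-- If `g = pt`, look at the submodule `tV` of the simple module `V`. It is nonzero, as `deg f > 1`
keeps `t` out of `Rf`; so `tV = V`, and then `p` kills `V` although its degree is less than that of
`g`. -/
theorem coeff_zero_ne_zero_of_annihilator (hφ : Function.Surjective (φ : D → D))
    (hm : 1 < natDegree f) (hf : Irreducible f) {g : SkewPolynomial D} (hg0 : g ≠ 0)
    (hg : Module.annihilator (SkewPolynomial D) (V f) = Ideal.span {g}) : coeff g 0 ≠ 0 := by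
  intro h0
  obtain ⟨p, rfl⟩ := exists_eq_mul_X h0
  have hX : natDegree (X : SkewPolynomial D) = 1 := natDegree_monomial one_ne_zero
  let W : Submodule (SkewPolynomial D) (V f) :=
    { carrier := {x | ∃ y : V f, x = (X : SkewPolynomial D) • y}
      zero_mem' := ⟨0, (smul_zero _).symm⟩
      add_mem' := by
        rintro _ _ ⟨y, rfl⟩ ⟨z, rfl⟩
        exact ⟨y + z, (smul_add _ _ _).symm⟩
      smul_mem' := by
        rintro r _ ⟨y, rfl⟩
        obtain ⟨q, hq⟩ := exists_mul_X_eq_X_mul hφ r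
        exact ⟨q • y, by rw [smul_smul, smul_smul, hq]⟩ }
  have := isSimpleModule_V hf
  rcases eq_bot_or_eq_top W with hW | hW
  · have h1 : (X : SkewPolynomial D) • (Submodule.Quotient.mk 1 : V f) ∈ W := ⟨_, rfl⟩
    rw [hW, Submodule.mem_bot, ← Submodule.Quotient.mk_smul, smul_eq_mul, mul_one,
      Submodule.Quotient.mk_eq_zero] at h1
    have := natDegree_le_of_mem_span h1 (right_ne_zero_of_mul hg0)
    omega
  · have h1 : p ∈ Module.annihilator (SkewPolynomial D) (V f) := by
      refine Module.mem_annihilator.2 fun x => ?_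
      obtain ⟨y, rfl⟩ : x ∈ W := hW ▸ Submodule.mem_top
      rw [smul_smul]
      exact Module.mem_annihilator.1 (hg ▸ Ideal.mem_span_singleton_self _) y
    rw [hg] at h1
    have h2 := natDegree_le_of_mem_span h1 (left_ne_zero_of_mul hg0)
    rw [natDegree_mul (left_ne_zero_of_mul hg0) (right_ne_zero_of_mul hg0)] at h2
    omega

/-- The minimal central left multiple of `f` generates the annihilator of `R / R f`. -/
theorem annihilator_V_eq_span {u : D} {n : ℕ} (hφ : Function.Surjective (φ : D → D)) (hn : 0 < n)
    (hu : u ≠ 0) (hun : ∀ z : D, φ^[n] z = u * z * u⁻¹)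
    (hmin : ∀ j, 0 < j → j < n → ¬ ∃ w : D, w ≠ 0 ∧ ∀ z, φ^[j] z = w * z * w⁻¹)
    (hφu : φ u = u) (hm : 1 < natDegree f) (hf : Irreducible f) {q : (FieldF D)[X]}
    (hq : IsMinCentralLeftMultiple u n f q) :
    Module.annihilator (SkewPolynomial D) (V f) = Ideal.span {centralEval u n q} := by
  have hh0 := centralEval_ne_zero hn hun hu hq.monic.ne_zero
  have hh : centralEval u n q ∈ Module.annihilator (SkewPolynomial D) (V f) := by
    refine Module.mem_annihilator.2 fun x => ?_
    obtain ⟨r, rfl⟩ := Submodule.Quotient.mk_surjective _ x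
    obtain ⟨p, hp⟩ := hq.mem
    rw [← Submodule.Quotient.mk_smul, smul_eq_mul, (centralEval_commute hun hu hφu q r).eq, hp,
      ← mul_assoc, Submodule.Quotient.mk_eq_zero]
    exact mul_mem_span _ _
  obtain ⟨g, hg, hgann⟩ := exists_monic_eq_span (Module.annihilator (SkewPolynomial D) (V f))
    ((Submodule.ne_bot_iff _).2 ⟨_, hh, hh0⟩)
  have hgmem : g ∈ Module.annihilator (SkewPolynomial D) (V f) :=
    hgann ▸ Ideal.mem_span_singleton_self g
  have hg0 : g ≠ 0 := by
    rintro rfl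
    exact zero_ne_one hg
  obtain ⟨s, q', hq'⟩ := exists_eq_C_mul_centralEval hn hu hun hmin hφu hg
    (coeff_zero_ne_zero_of_annihilator hφ hm hf hg0 hgann)
    (fun r => hgann ▸ Module.mem_annihilator.2 fun x => by
      rw [mul_smul]
      exact Module.mem_annihilator.1 hgmem _)
  have hus : u ^ s ≠ 0 := pow_ne_zero s hu
  -- Up to the unit `u^s`, `g` is itself a central left multiple of `f`, so minimality bounds `deg
  -- h` by `deg g`. As `h` is a left multiple of `g`, the cofactor is a unit.
  have hdeg : natDegree (centralEval u n q) ≤ natDegree g := by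
    have hc : centralEval u n q' = C (u ^ s)⁻¹ * g := by
      rw [hq', ← mul_assoc, ← C_mul, inv_mul_cancel₀ hus, C_1, one_mul]
    rw [hq', natDegree_C_mul hus]
    refine hq.minimal q' ?_ ?_
    · rintro rfl
      rw [centralEval, map_zero, mul_zero] at hq'
      exact hg0 hq'
    · rw [hc]
      exact exists_eq_mul_of_mem_span
        (Ideal.mul_mem_left _ _ (mem_span_of_mem_annihilator hgmem))
  rw [hgann] at hh ⊢
  obtain ⟨p, hp⟩ := exists_eq_mul_of_mem_span hh
  have hp0 : p ≠ 0 := fun h => hh0 (by rw [hp, h, zero_mul])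
  rw [hp, natDegree_mul hp0 hg0] at hdeg
  obtain ⟨w, hw⟩ := isUnit_of_natDegree_eq_zero hp0 (by omega)
  refine le_antisymm ?_ ((Ideal.span_singleton_le_iff_mem _).2 hh)
  rw [Ideal.span_singleton_le_iff_mem]
  have : g = (↑w⁻¹ : SkewPolynomial D) * centralEval u n q := by
    rw [hp, ← hw, Units.inv_mul_cancel_left]
  rw [this]
  exact mul_mem_span _ _

end Annihilator

/-! ### Number of irreducible factors as module length. -/

section Length

variable {D : Type*} [DivisionRing D] [MulSemiringAction (Multiplicative ℕ) D]

/-- The inclusion `R / R p → R / R p q`, `x ↦ x q`. -/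
def mulRightV (p q : SkewPolynomial D) : V p →ₗ[SkewPolynomial D] V (p * q) :=
  Submodule.mapQ _ _ (LinearMap.toSpanSingleton (SkewPolynomial D) (SkewPolynomial D) q) <| by
    rw [Submodule.span_le, Set.singleton_subset_iff]
    exact Ideal.mem_span_singleton_self (p * q)

theorem mulRightV_mk (p q r : SkewPolynomial D) :
    mulRightV p q (Submodule.Quotient.mk r) = Submodule.Quotient.mk (r * q) := rfl

theorem mulRightV_injective (p : SkewPolynomial D) {q : SkewPolynomial D} (hq : q ≠ 0) :
    Function.Injective (mulRightV p q) := by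
  refine (injective_iff_map_eq_zero _).2 fun x hx => ?_
  obtain ⟨r, rfl⟩ := Submodule.Quotient.mk_surjective _ x
  rw [mulRightV_mk, Submodule.Quotient.mk_eq_zero] at hx
  obtain ⟨s, hs⟩ := exists_eq_mul_of_mem_span hx
  rw [← mul_assoc] at hs
  rw [Submodule.Quotient.mk_eq_zero, mul_right_cancel₀ hq hs]
  exact mul_mem_span _ _

/-- Additivity of length in the exact sequence `0 → R/Rp → R/Rpq → R/Rq → 0`, whose first map is
right multiplication by `q`. -/
theorem length_V_mul (p : SkewPolynomial D) {q : SkewPolynomial D} (hq : q ≠ 0) :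
    Module.length (SkewPolynomial D) (V (p * q)) =
      Module.length (SkewPolynomial D) (V p) + Module.length (SkewPolynomial D) (V q) := by
  have hle : (Ideal.span {p * q} : Ideal (SkewPolynomial D)) ≤ Ideal.span {q} :=
    (Ideal.span_singleton_le_iff_mem _).2 (mul_mem_span p q)
  refine Module.length_eq_add_of_exact (mulRightV p q) (Submodule.factor hle)
    (mulRightV_injective p hq) (Submodule.factor_surjective hle) fun x => ?_
  obtain ⟨r, rfl⟩ := Submodule.Quotient.mk_surjective _ x
  change (Submodule.Quotient.mk r : V q) = 0 ↔ _
  rw [Submodule.Quotient.mk_eq_zero]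
  constructor
  · intro h
    obtain ⟨s, rfl⟩ := exists_eq_mul_of_mem_span h
    exact ⟨Submodule.Quotient.mk s, rfl⟩
  · rintro ⟨y, hy⟩
    obtain ⟨s, rfl⟩ := Submodule.Quotient.mk_surjective _ y
    rw [mulRightV_mk, Submodule.Quotient.eq] at hy
    exact (Submodule.sub_mem_iff_right _ (mul_mem_span s q)).1 (hle hy)

theorem length_V_of_hasNumFactors {h : SkewPolynomial D} {k : ℕ} (hk : HasNumFactors h k) :
    Module.length (SkewPolynomial D) (V h) = k := by
  obtain ⟨P, hP, rfl, rfl⟩ := hk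
  induction P with
  | nil =>
    have : Subsingleton (V (List.prod ([] : List (SkewPolynomial D)))) :=
      Submodule.Quotient.subsingleton_iff.2 (span_eq_top_of_isUnit isUnit_one)
    exact Module.length_eq_zero
  | cons p P ih =>
    have := isSimpleModule_V (hP p (by simp))
    rw [List.prod_cons, length_V_mul, ih fun q hq => hP q (by simp [hq]), Module.length_eq_one,
      List.length_cons, Nat.cast_succ, add_comm]
    exact List.prod_ne_zero fun h0 => (hP 0 (by simp [h0])).ne_zero rfl

end Length

/-! ### Evaluation at independent vectors, and the resulting counts. -/

section Counting

variable {D : Type*} [DivisionRing D] [MulSemiringAction (Multiplicative ℕ) D]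
variable {f : SkewPolynomial D}

/-- The evaluation `R → V ^ ι`, `r ↦ (r v_i)`. -/
def evalMap {ι : Type*} (v : ι → V f) :
    SkewPolynomial D →ₗ[SkewPolynomial D] (ι → V f) :=
  LinearMap.pi fun i => LinearMap.toSpanSingleton (SkewPolynomial D) (V f) (v i)

theorem mem_ker_evalMap {ι : Type*} {v : ι → V f} {r : SkewPolynomial D} :
    r ∈ LinearMap.ker (evalMap v) ↔ ∀ i, r • v i = 0 := by
  rw [LinearMap.mem_ker, funext_iff]
  rfl

theorem evalMap_surjective (hm : 1 < natDegree f) (hf : coeff f (natDegree f) = 1)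
    (hirr : Irreducible f) {ι : Type*} [Finite ι] {v : ι → V f}
    (hv : LinearIndependent (NucB f)ᵐᵒᵖ v) : Function.Surjective (evalMap v) := fun w => by
  obtain ⟨r, hr⟩ := exists_smul_eq hm hf hirr hv w
  exact ⟨r, funext hr⟩

/-- Left multiplications are `B`-linear, so one that kills a basis kills `V`. -/
theorem ker_evalMap_basis (hm : 1 < natDegree f) (hf : coeff f (natDegree f) = 1)
    {ι : Type*} (v : Module.Basis ι (NucB f)ᵐᵒᵖ (V f)) :
    LinearMap.ker (evalMap v) = Module.annihilator (SkewPolynomial D) (V f) := by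
  have := smulCommClass_V hm hf
  have : SMulCommClass (SkewPolynomial D) (NucB f)ᵐᵒᵖ (V f) := SMulCommClass.symm _ _ _
  ext r
  rw [mem_ker_evalMap, Module.mem_annihilator]
  refine ⟨fun h x => ?_, fun h i => h _⟩
  have h1 : (Module.toModuleEnd (NucB f)ᵐᵒᵖ (V f) r : V f →ₗ[(NucB f)ᵐᵒᵖ] V f) = 0 :=
    v.ext fun i => h i
  exact LinearMap.congr_fun h1 x

/-- `R / R g ≃ V ^ ι` for a generator `g` of the left ideal of all elements killing a finite
linearly independent family of vectors of `V`. -/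
def quotEquivPi (hm : 1 < natDegree f) (hf : coeff f (natDegree f) = 1)
    (hirr : Irreducible f) {ι : Type*} [Finite ι] {v : ι → V f}
    (hv : LinearIndependent (NucB f)ᵐᵒᵖ v) {g : SkewPolynomial D}
    (hg : LinearMap.ker (evalMap v) = Ideal.span {g}) :
    V g ≃ₗ[SkewPolynomial D] (ι → V f) :=
  (Submodule.quotEquivOfEq _ _ hg.symm).trans
    ((evalMap v).quotKerEquivOfSurjective (evalMap_surjective hm hf hirr hv))

/-- The number of irreducible factors of a generator of the annihilator of `V` is `dim_B V`. -/
theorem card_eq_of_hasNumFactors (hm : 1 < natDegree f) (hf : coeff f (natDegree f) = 1)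
    (hirr : Irreducible f) {ι : Type*} [Fintype ι] (v : Module.Basis ι (NucB f)ᵐᵒᵖ (V f))
    {h : SkewPolynomial D} (hh : Module.annihilator (SkewPolynomial D) (V f) = Ideal.span {h})
    {k : ℕ} (hk : HasNumFactors h k) : Fintype.card ι = k := by
  have := isSimpleModule_V hirr
  have h1 := (quotEquivPi hm hf hirr v.linearIndependent
    ((ker_evalMap_basis hm hf v).trans hh)).length_eq
  rw [length_V_of_hasNumFactors hk, Module.length_pi, Module.length_eq_one, mul_one,
    ENat.card_eq_coe_fintype_card] at h1
  exact_mod_cast h1.symm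

/-- `R/Rg ≅ V^ι`; both `K`-dimensions are a degree times `[D:K]`, and `[D:K]` cancels. -/
theorem natDegree_of_ker_evalMap (K : Type*) [Field K] [Algebra K D] [SMulCommClass (Multiplicative ℕ) K D]
    [Module.Finite K D]
    (hm : 1 < natDegree f) (hf : coeff f (natDegree f) = 1)
    (hirr : Irreducible f) {ι : Type*} [Fintype ι] {v : ι → V f}
    (hv : LinearIndependent (NucB f)ᵐᵒᵖ v) {g : SkewPolynomial D} (hg0 : g ≠ 0)
    (hg : LinearMap.ker (evalMap v) = Ideal.span {g}) :
    natDegree g = Fintype.card ι * natDegree f := by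
  have h1 := ((quotEquivPi hm hf hirr hv hg).restrictScalars K).finrank_eq
  have := finite_V K hirr.ne_zero
  rw [finrank_V K hg0, Module.finrank_pi_fintype, Finset.sum_const, finrank_V K hirr.ne_zero,
    Finset.card_univ, smul_eq_mul, ← mul_assoc] at h1
  exact Nat.eq_of_mul_eq_mul_right Module.finrank_pos h1

theorem finite_NucB (K : Type*) [Field K] [Algebra K D] [SMulCommClass (Multiplicative ℕ) K D]
    [Module.Finite K D]
    (hf0 : f ≠ 0) : Module.Finite K (NucB f) := by
  have : Module.Finite K (reduced f) := Module.Finite.equiv (reducedEquiv K hf0).symm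
  let T : NucB f →ₗ[K] reduced f :=
    { toFun := fun b => (b : PetitAlgebra f)
      map_add' := fun _ _ => rfl
      map_smul' := fun _ _ => rfl }
  exact Module.Finite.of_injective T fun a b h => Subtype.ext h

theorem finite_op_V (K : Type*) [Field K] [Algebra K D] [SMulCommClass (Multiplicative ℕ) K D]
    [Module.Finite K D]
    (hm : 1 < natDegree f) (hf : coeff f (natDegree f) = 1)
    (hirr : Irreducible f) : Module.Finite (NucB f)ᵐᵒᵖ (V f) := by
  have := finite_V K hirr.ne_zero
  have := isScalarTower_V hm hf K
  exact Module.Finite.of_restrictScalars_finite K _ _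

theorem nonempty_basis (K : Type*) [Field K] [Algebra K D] [SMulCommClass (Multiplicative ℕ) K D]
    [Module.Finite K D]
    (hm : 1 < natDegree f) (hf : coeff f (natDegree f) = 1)
    (hirr : Irreducible f) {h : SkewPolynomial D}
    (hh : Module.annihilator (SkewPolynomial D) (V f) = Ideal.span {h})
    {k : ℕ} (hk : HasNumFactors h k) :
    Nonempty (Module.Basis (Fin k) (NucB f)ᵐᵒᵖ (V f)) := by
  let := divisionRingOp hm hf hirr
  have := finite_op_V K hm hf hirr
  let b := Module.finBasis (NucB f)ᵐᵒᵖ (V f)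
  have h1 := card_eq_of_hasNumFactors hm hf hirr b hh hk
  exact ⟨b.reindex (finCongr (by rwa [Fintype.card_fin] at h1))⟩

/-- The `K`-dimension of `V` counted twice: through `B` by the tower law, and through coefficients
in `D`. -/
theorem card_mul_finrank_NucB (K : Type*) [Field K] [Algebra K D] [SMulCommClass (Multiplicative ℕ) K D]
    [Module.Finite K D]
    (hm : 1 < natDegree f) (hf : coeff f (natDegree f) = 1)
    (hirr : Irreducible f) {ι : Type*} [Fintype ι] (v : Module.Basis ι (NucB f)ᵐᵒᵖ (V f)) :
    Fintype.card ι * Module.finrank K (NucB f) = natDegree f * Module.finrank K D := by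
  let := divisionRingOp hm hf hirr
  have := isScalarTower_V hm hf K
  rw [← finrank_V K hirr.ne_zero, ← Module.finrank_mul_finrank K (NucB f)ᵐᵒᵖ (V f),
    Module.finrank_eq_card_basis v, mul_comm, (opLinearEquiv K (M := NucB f)).finrank_eq]

end Counting

/-! ### Irreducible factors when `R/Rg` is a power of `R/Rf`. -/

section Similarity

variable {D : Type*} [DivisionRing D] [MulSemiringAction (Multiplicative ℕ) D]
variable {f : SkewPolynomial D}

/-- If `R / R g` is a power of `R / R f`, then all irreducible factors of `g` are similar to `f`. -/
theorem allIrreducibleFactorsSimilar_of_equiv (hf : Irreducible f) {g : SkewPolynomial D}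
    (hg : g ≠ 0) {ι : Type*} [Finite ι] (e : V g ≃ₗ[SkewPolynomial D] (ι → V f)) :
    AllIrreducibleFactorsSimilar g f := by
  classical
  rintro p hp ⟨x, y, rfl⟩
  have := isSimpleModule_V hf
  have := isSimpleModule_V hp
  have hy : y ≠ 0 := right_ne_zero_of_mul hg
  have hle : (Ideal.span {x * p * y} : Ideal (SkewPolynomial D)) ≤ Ideal.span {p * y} := by
    rw [Ideal.span_singleton_le_iff_mem, mul_assoc]
    exact mul_mem_span _ _
  let q : (ι → V f) →ₗ[SkewPolynomial D] V (p * y) := Submodule.factor hle ∘ₗ e.symm.toLinearMap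
  have hq : Function.Surjective q := (Submodule.factor_surjective hle).comp e.symm.surjective
  have := IsSemisimpleModule.of_surjective q hq
  -- `R/Rp` sits inside `R/Rpy`, a quotient of the semisimple module `V^ι`, hence splits off. The
  -- resulting surjection `V^ι → R/Rp` is nonzero on some coordinate, where Schur's lemma makes it
  -- an isomorphism.
  obtain ⟨π, hπ⟩ := IsSemisimpleModule.extension_property (mulRightV p y)
    (mulRightV_injective p hy) LinearMap.id
  have hsurj : Function.Surjective (π ∘ₗ q) := by
    have hπ' : Function.Surjective π := fun z => ⟨mulRightV p y z, LinearMap.congr_fun hπ z⟩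
    exact hπ'.comp hq
  obtain ⟨i, hi⟩ : ∃ i, (π ∘ₗ q) ∘ₗ LinearMap.single (SkewPolynomial D) (fun _ => V f) i ≠ 0 := by
    by_contra! hall
    have h0 : π ∘ₗ q = 0 := LinearMap.pi_ext' fun i => by rw [hall i, LinearMap.zero_comp]
    have := IsSimpleModule.nontrivial (SkewPolynomial D) (V p)
    obtain ⟨z, hz⟩ := exists_ne (0 : V p)
    obtain ⟨w, rfl⟩ := hsurj z
    exact hz (by rw [h0, LinearMap.zero_apply])
  exact ⟨(LinearEquiv.ofBijective _ (LinearMap.bijective_of_ne_zero hi)).symm⟩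

end Similarity

/-! ### Matrices of left multiplications. -/

section LeftMul

variable {D : Type*} [DivisionRing D] [MulSemiringAction (Multiplicative ℕ) D]
variable {f : SkewPolynomial D}

/-- The left multiplication `x ↦ a x` of `V` as a `B`-linear map. -/
def leftMul (hm : 1 < natDegree f) (hf : coeff f (natDegree f) = 1) (a : SkewPolynomial D) :
    V f →ₗ[(NucB f)ᵐᵒᵖ] V f where
  toFun x := a • x
  map_add' := smul_add a
  map_smul' b x := ((smulCommClass_V hm hf).smul_comm b a x).symm

/-- Elements of `Rh` kill `V`, so the matrix depends only on the class modulo `Rh`. -/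
theorem code_eq_image {ι : Type*} (v : Module.Basis ι (NucB f)ᵐᵒᵖ (V f))
    {h : SkewPolynomial D} (hh : Module.annihilator (SkewPolynomial D) (V f) = Ideal.span {h})
    (ν : D) (ρ : D ≃+* D) (N : ℕ) :
    code v h (setS ν ρ N h) = leftMulMatrix v '' setA ν ρ N := by
  ext M
  constructor
  · rintro ⟨a, ⟨a', ha', haa'⟩, rfl⟩
    refine ⟨a', ha', ?_⟩
    rw [Submodule.Quotient.eq, ← hh, Module.mem_annihilator] at haa'
    ext1 i j
    have := haa' (v j)
    rw [sub_smul, sub_eq_zero] at this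
    rw [leftMulMatrix, leftMulMatrix, this]
  · rintro ⟨a, ha, rfl⟩
    exact ⟨a, ⟨a, ha, rfl⟩, rfl⟩

variable {ι : Type*} [Fintype ι] (v : Module.Basis ι (NucB f)ᵐᵒᵖ (V f))

/-- The coordinates with respect to a right `B`-basis of `V`, with values in `B`. -/
def coordEquiv : V f ≃ₗ[(NucB f)ᵐᵒᵖ] (ι → NucB f) where
  toFun x i := unop (v.repr x i)
  map_add' x y := by ext i; simp
  map_smul' b x := by
    ext i
    rw [map_smul]
    rfl
  invFun y := v.equivFun.symm fun i => op (y i)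
  left_inv x := by
    simp only [op_unop]
    exact v.equivFun.symm_apply_apply x
  right_inv y := by
    funext i
    exact congrArg unop (congrFun (v.equivFun.apply_symm_apply fun i => op (y i)) i)

/-- The columns are the coordinate vectors of the `a v_j`, and these span the range of left
multiplication by `a`. -/
theorem colRank_leftMulMatrix (hm : 1 < natDegree f) (hf : coeff f (natDegree f) = 1)
    (a : SkewPolynomial D) :
    colRank (leftMulMatrix v a) =
      Module.finrank (NucB f)ᵐᵒᵖ (LinearMap.range (leftMul hm hf a)) := by
  have h1 : (Set.range fun j : ι => fun i : ι => leftMulMatrix v a i j) =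
      coordEquiv v '' (leftMul hm hf a '' Set.range v) := by
    rw [← Set.range_comp, ← Set.range_comp]
    rfl
  rw [colRank, h1, ← LinearEquiv.coe_coe, Submodule.span_image, Submodule.span_image, v.span_eq,
    Submodule.map_top]
  exact LinearEquiv.finrank_map_eq (coordEquiv v) _

/-- The map `a ↦ M_a`. -/
def leftMulMatrixLinear (K : Type*) [Field K] [Algebra K D]
    [SMulCommClass (Multiplicative ℕ) K D] (hm : 1 < natDegree f)
    (hf : coeff f (natDegree f) = 1) : SkewPolynomial D →ₗ[K] Matrix ι ι (NucB f) where
  toFun := leftMulMatrix v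
  map_add' a b := by
    ext1 i j
    change unop (v.repr ((a + b) • v j) i) = _
    rw [add_smul, map_add]
    rfl
  map_smul' c a := by
    have := isScalarTower_V hm hf K
    ext1 i j
    change unop (v.repr ((c • a) • v j) i) = _
    rw [smul_assoc]
    have h1 := (v.repr.toLinearMap.restrictScalars K).map_smul c (a • v j)
    change v.repr _ = c • v.repr _ at h1
    rw [h1]
    rfl

theorem leftMulMatrix_eq_zero_iff (hm : 1 < natDegree f) (hf : coeff f (natDegree f) = 1)
    (a : SkewPolynomial D) : leftMulMatrix v a = 0 ↔
      a ∈ Module.annihilator (SkewPolynomial D) (V f) := by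
  rw [← ker_evalMap_basis hm hf v, mem_ker_evalMap]
  constructor
  · intro h j
    refine (coordEquiv v).map_eq_zero_iff.1 ?_
    ext1 i
    exact congrFun (congrFun h i) j
  · intro h
    ext1 i j
    change coordEquiv v (a • v j) i = 0
    rw [h, map_zero, Pi.zero_apply]

end LeftMul

/-! ### Linear parametrization of `A`. -/

section SetA

variable {D : Type*} [DivisionRing D]

/-- The parametrization of the set `A` by the coefficients `d_0, …, d_{N-1}`. -/
def setALinear (K : Type*) [Field K] [Algebra K D] (ν : D) (ρ : D ≃+* D)
    (hρ : ∀ c : K, ρ (algebraMap K D c) = algebraMap K D c) (N : ℕ) [NeZero N] :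
    (Fin N → D) →ₗ[K] SkewPolynomial D where
  toFun d := (∑ i : Fin N, monomial i.1 (d i)) + monomial N (ν * ρ (d 0))
  map_add' d e := by
    simp only [Pi.add_apply, map_add, mul_add, Finset.sum_add_distrib]
    abel
  map_smul' c d := by
    -- The twisted top coefficient is linear only over scalars fixed by `ρ`; this is why the code is
    -- linear over `F'`.
    have h1 : ν * ρ (c • d 0) = c • (ν * ρ (d 0)) := by
      rw [Algebra.smul_def, map_mul, hρ, ← Algebra.smul_def, mul_smul_comm]
    simp only [Pi.smul_apply, h1, RingHom.id_apply, smul_add, Finset.smul_sum, smul_monomial]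

variable (K : Type*) [Field K] [Algebra K D] (ν : D) (ρ : D ≃+* D)
    (hρ : ∀ c : K, ρ (algebraMap K D c) = algebraMap K D c) (N : ℕ) [NeZero N]

theorem setALinear_apply (d : Fin N → D) : setALinear K ν ρ hρ N d =
    (∑ i : Fin N, monomial i.1 (d i)) + monomial N (ν * ρ (d 0)) := rfl

theorem coeff_setALinear (d : Fin N → D) (i : Fin N) : coeff (setALinear K ν ρ hρ N d) i = d i := by
  rw [setALinear_apply, coeff_add, coeff_sum, Finset.sum_eq_single i (fun j _ hj => ?_) (by simp),
    coeff_monomial, if_pos rfl, coeff_monomial, if_neg (by omega), add_zero]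
  rw [coeff_monomial, if_neg fun h => hj (Fin.ext h)]

theorem setALinear_injective : Function.Injective (setALinear K ν ρ hρ N) := fun d e h => by
  ext i
  rw [← coeff_setALinear K ν ρ hρ N d, h, coeff_setALinear]

theorem natDegree_setALinear_le (d : Fin N → D) : natDegree (setALinear K ν ρ hρ N d) ≤ N := by
  refine natDegree_le fun j hj => ?_
  rw [setALinear_apply, coeff_add, coeff_sum, coeff_monomial, if_neg hj.ne, add_zero]
  exact Finset.sum_eq_zero fun i _ => by rw [coeff_monomial, if_neg (by omega)]

variable [MulSemiringAction (Multiplicative ℕ) D]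

theorem range_setALinear : Set.range (setALinear K ν ρ hρ N) = setA ν ρ N := by
  ext a
  constructor
  · rintro ⟨d, rfl⟩
    refine ⟨fun i => if h : i < N then d ⟨i, h⟩ else 0, ?_⟩
    rw [setALinear_apply, Finset.sum_range]
    simp only [C_mul_X_pow_eq_monomial, Fin.is_lt, dif_pos, Fin.eta, NeZero.pos]
    rfl
  · rintro ⟨d, rfl⟩
    refine ⟨fun i => d i, ?_⟩
    rw [setALinear_apply, Finset.sum_range]
    simp only [C_mul_X_pow_eq_monomial, Fin.val_zero]

end SetA

/-! ### Minimum distance and dimension of the code. -/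

section MRD

variable {D : Type*} [DivisionRing D] [MulSemiringAction (Multiplicative ℕ) D]
variable {f : SkewPolynomial D}

/-- A nonzero `a` of degree at most `l · deg f` that kills `l` linearly independent vectors of `V`
has degree `l · deg f`, and all its irreducible factors are similar to `f`. -/
theorem natDegree_eq_and_similar_of_le_finrank_ker (K : Type*) [Field K] [Algebra K D]
    [SMulCommClass (Multiplicative ℕ) K D] [Module.Finite K D]
    (hm : 1 < natDegree f) (hf : coeff f (natDegree f) = 1) (hirr : Irreducible f)
    {a : SkewPolynomial D} (ha : a ≠ 0) {l : ℕ} (hdeg : natDegree a ≤ l * natDegree f)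
    (hl : l ≤ Module.finrank (NucB f)ᵐᵒᵖ (LinearMap.ker (leftMul hm hf a))) :
    natDegree a = l * natDegree f ∧ AllIrreducibleFactorsSimilar a f := by
  let := divisionRingOp hm hf hirr
  obtain ⟨w, hw⟩ := exists_linearIndependent_of_le_finrank hl
  have hw' := hw.map' _ (Submodule.ker_subtype _)
  set w' : Fin l → V f := (LinearMap.ker (leftMul hm hf a)).subtype ∘ w with hw'def
  have hmem : a ∈ LinearMap.ker (evalMap w') := mem_ker_evalMap.2 fun i => (w i).2
  obtain ⟨g, hg, hker⟩ := exists_monic_eq_span (LinearMap.ker (evalMap w'))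
    ((Submodule.ne_bot_iff _).2 ⟨a, hmem, ha⟩)
  rw [hker] at hmem
  obtain ⟨q, rfl⟩ := exists_eq_mul_of_mem_span hmem
  have hg0 := right_ne_zero_of_mul ha
  have hq0 := left_ne_zero_of_mul ha
  have hgdeg := natDegree_of_ker_evalMap K hm hf hirr hw' hg0 hker
  rw [Fintype.card_fin] at hgdeg
  have hadeg := natDegree_mul hq0 hg0
  -- The generator `g` already has degree `l · deg f`, so the cofactor `q` has degree zero.
  have hunit := isUnit_of_natDegree_eq_zero hq0 (by omega)
  have hspan : Ideal.span {q * g} = Ideal.span {g} := by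
    obtain ⟨s, rfl⟩ := hunit
    refine le_antisymm ((Ideal.span_singleton_le_iff_mem _).2 hmem)
      ((Ideal.span_singleton_le_iff_mem _).2 ?_)
    have := mul_mem_span (↑s⁻¹ : SkewPolynomial D) (↑s * g)
    rwa [Units.inv_mul_cancel_left] at this
  exact ⟨by omega, allIrreducibleFactorsSimilar_of_equiv hirr ha
    (quotEquivPi hm hf hirr hw' (hker.trans hspan.symm))⟩

theorem isGenMRDCode_code (K : Type*) [Field K] [Algebra K D]
    [SMulCommClass (Multiplicative ℕ) K D] [Module.Finite K D]
    (hm : 1 < natDegree f) (hf : coeff f (natDegree f) = 1) (hirr : Irreducible f)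
    {h : SkewPolynomial D} (hh0 : h ≠ 0)
    (hh : Module.annihilator (SkewPolynomial D) (V f) = Ideal.span {h})
    {ι : Type*} [Fintype ι] (v : Module.Basis ι (NucB f)ᵐᵒᵖ (V f)) (ν : D) (ρ : D ≃+* D)
    (hρ : ∀ c : K, ρ (algebraMap K D c) = algebraMap K D c) {l : ℕ} (hl : 0 < l)
    (hlk : l < Fintype.card ι)
    (hA : ¬ ∃ g ∈ setA ν ρ (l * natDegree f), natDegree g = l * natDegree f ∧
      AllIrreducibleFactorsSimilar g f) :
    IsGenMRDCode K (code v h (setS ν ρ (l * natDegree f) h)) (Fintype.card ι - l + 1) := by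
  let := divisionRingOp hm hf hirr
  have := finite_op_V K hm hf hirr
  have := finite_V K hirr.ne_zero
  have hN : 0 < l * natDegree f := Nat.mul_pos hl (by omega)
  have : NeZero (l * natDegree f) := ⟨hN.ne'⟩
  have hhdeg := natDegree_of_ker_evalMap K hm hf hirr v.linearIndependent hh0
    ((ker_evalMap_basis hm hf v).trans hh)
  let A := setALinear K ν ρ hρ (l * natDegree f)
  let L := leftMulMatrixLinear v K hm hf ∘ₗ A
  have hA0 : ∀ d, d ≠ 0 → A d ≠ 0 := fun d hd h0 =>
    hd (setALinear_injective K ν ρ hρ _ (h0.trans (map_zero _).symm))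
  -- The kernel of `a ↦ M_a` is `Rh`, and `deg h = km` exceeds the degree `lm` allowed in `A`.
  have hL : Function.Injective L := by
    refine (injective_iff_map_eq_zero _).2 fun d hd => ?_
    have h1 := (leftMulMatrix_eq_zero_iff v hm hf (A d)).1 hd
    by_contra hd0
    rw [hh] at h1
    have h2 := natDegree_le_of_mem_span h1 (hA0 d hd0)
    have h3 : natDegree (A d) ≤ _ := natDegree_setALinear_le K ν ρ hρ _ d
    have h4 := Nat.mul_lt_mul_of_pos_right hlk (show 0 < natDegree f by omega)
    omega
  have hcode : code v h (setS ν ρ (l * natDegree f) h) = Set.range L := by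
    rw [code_eq_image v hh, ← range_setALinear K ν ρ hρ, ← Set.range_comp]
    rfl
  have hrank : ∀ d, colRank (L d) +
      Module.finrank (NucB f)ᵐᵒᵖ (LinearMap.ker (leftMul hm hf (A d))) = Fintype.card ι := fun d => by
    rw [← Module.finrank_eq_card_basis v, ← LinearMap.finrank_range_add_finrank_ker
      (leftMul hm hf (A d)), ← colRank_leftMulMatrix v hm hf (A d)]
    rfl
  have hker : ∀ d, d ≠ 0 →
      Module.finrank (NucB f)ᵐᵒᵖ (LinearMap.ker (leftMul hm hf (A d))) < l := fun d hd => by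
    by_contra! hle
    refine hA ⟨A d, ?_, natDegree_eq_and_similar_of_le_finrank_ker K hm hf hirr (hA0 d hd)
      (natDegree_setALinear_le K ν ρ hρ _ d) hle⟩
    rw [← range_setALinear K ν ρ hρ]
    exact ⟨d, rfl⟩
  refine ⟨nontrivial_NucB hm, isUnit_NucB hm hf hirr, finite_NucB K hirr.ne_zero, ⟨?_, ?_⟩,
    by omega, LinearMap.range L, ?_, ?_⟩
  · obtain ⟨w, hw⟩ := exists_linearIndependent_of_le_finrank
      (R := (NucB f)ᵐᵒᵖ) (M := V f) (n := l - 1) (by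
        rw [Module.finrank_eq_card_basis v]
        omega)
    -- Evaluation of `A` at `l-1` independent vectors has a target of smaller `K`-dimension, so a
    -- nonzero element of `A` kills them all. Its nullity is then exactly `l-1`.
    let E : (Fin (l * natDegree f) → D) →ₗ[K] (Fin (l - 1) → V f) :=
      (evalMap w).restrictScalars K ∘ₗ A
    have hE : LinearMap.ker E ≠ ⊥ := by
      refine LinearMap.ker_ne_bot_of_finrank_lt ?_
      rw [Module.finrank_pi_fintype, Module.finrank_pi_fintype, Finset.sum_const, Finset.sum_const,
        finrank_V K hirr.ne_zero, Finset.card_univ, Finset.card_univ, Fintype.card_fin,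
        Fintype.card_fin, smul_eq_mul, smul_eq_mul, mul_assoc]
      exact Nat.mul_lt_mul_of_pos_right (by omega)
        (Nat.mul_pos (by omega) Module.finrank_pos)
    obtain ⟨d, hd, hd0⟩ := Submodule.exists_mem_ne_zero_of_ne_bot hE
    have hwd : ∀ i, w i ∈ LinearMap.ker (leftMul hm hf (A d)) := fun i =>
      congrFun (LinearMap.mem_ker.1 hd) i
    have hw2 : LinearIndependent (NucB f)ᵐᵒᵖ
        (fun i => (⟨w i, hwd i⟩ : LinearMap.ker (leftMul hm hf (A d)))) :=
      LinearIndependent.of_comp (Submodule.subtype _) hw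
    have h1 := hw2.fintype_card_le_finrank
    rw [Fintype.card_fin] at h1
    refine ⟨L d, hcode ▸ ⟨d, rfl⟩, L 0, hcode ▸ ⟨0, rfl⟩, fun h0 => hd0 (hL h0), ?_⟩
    rw [map_zero, sub_zero]
    have h2 := hrank d
    have h3 := hker d hd0
    omega
  · rintro r ⟨M, hM, M', hM', hne, rfl⟩
    rw [hcode] at hM hM'
    obtain ⟨d, rfl⟩ := hM
    obtain ⟨d', rfl⟩ := hM'
    rw [← map_sub]
    have h2 := hrank (d - d')
    have h3 := hker (d - d') (sub_ne_zero.2 fun h0 => hne (by rw [h0]))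
    omega
  · rw [hcode]
    rfl
  · rw [LinearMap.finrank_range_of_inj hL, Module.finrank_pi_fintype, Finset.sum_const,
      Finset.card_univ, Fintype.card_fin, smul_eq_mul]
    have h1 := card_mul_finrank_NucB K hm hf hirr v
    have h2 : Fintype.card ι - (Fintype.card ι - l + 1) + 1 = l := by omega
    rw [h2, mul_assoc, ← h1]
    ring

end MRD

/-! ### Transport of codes along a ring isomorphism. -/

section Transfer

theorem colRank_map {ι B E : Type*} [Ring B] [Ring E] (e : B ≃+* E) (M : Matrix ι ι B) :
    colRank (M.map e) = colRank M := by
  let s : Bᵐᵒᵖ ≃+* Eᵐᵒᵖ := RingEquiv.op e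
  have := RingHomInvPair.of_ringEquiv s
  have := RingHomInvPair.of_ringEquiv s.symm
  let J : (ι → B) →ₛₗ[(s : Bᵐᵒᵖ →+* Eᵐᵒᵖ)] (ι → E) :=
    { toFun := fun x i => e (x i)
      map_add' := fun x y => funext fun i => map_add e _ _
      map_smul' := fun b x => funext fun i => map_mul e _ _ }
  have hJ : Function.Injective J := fun x y h => funext fun i => e.injective (congrFun h i)
  have h1 : (Set.range fun j : ι => fun i : ι => (M.map e) i j) =
      J '' (Set.range fun j : ι => fun i : ι => M i j) := by
    rw [← Set.range_comp]
    rfl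
  rw [colRank, colRank, h1, ← Submodule.map_span]
  let j := Submodule.equivMapOfInjective (σ₂₁ := (s.symm : Eᵐᵒᵖ →+* Bᵐᵒᵖ)) J hJ
    (Submodule.span Bᵐᵒᵖ (Set.range fun j : ι => fun i : ι => M i j))
  -- The spans are modules over different rings, so their ranks are compared through the semilinear
  -- bijection `j`.
  have h2 := lift_rank_eq_of_equiv_equiv (s : Bᵐᵒᵖ → Eᵐᵒᵖ) j.toAddEquiv s.bijective
    (fun r m => j.map_smulₛₗ r m)
  have h3 := congrArg Cardinal.toNat h2
  rw [Cardinal.toNat_lift, Cardinal.toNat_lift] at h3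
  exact h3.symm

theorem IsGenMRDCode.map {L : Type*} [Field L] {ι B E : Type*} [Fintype ι] [Ring B] [Module L B]
    [Ring E] [Module L E] (e : B ≃+* E) (he : ∀ (c : L) (b : B), e (c • b) = c • e b)
    {𝒞 : Set (Matrix ι ι B)} {δ : ℕ} (h : IsGenMRDCode L 𝒞 δ) :
    IsGenMRDCode L ((fun M => M.map e) '' 𝒞) δ := by
  let eL : B ≃ₗ[L] E := { e with map_smul' := he }
  let T : Matrix ι ι B →ₗ[L] Matrix ι ι E :=
    { toFun := fun M => M.map e
      map_add' := fun M N => Matrix.map_add e (map_add e) M N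
      map_smul' := fun c M => by
        ext1 i j
        exact he c _ }
  have hT : Function.Injective T := Matrix.map_injective e.injective
  have hsub : ∀ M N : Matrix ι ι B, colRank (T M - T N) = colRank (M - N) := fun M N => by
    rw [← map_sub]
    exact colRank_map e _
  obtain ⟨⟨M, hM, N, hN, hne, hr⟩, hlow⟩ := h.minDist
  have := h.nontrivial
  have := h.finite
  obtain ⟨W, hW, hdim⟩ := h.linear
  refine ⟨e.injective.nontrivial, fun b hb => ?_, Module.Finite.equiv eL, ⟨?_, ?_⟩,
    h.dist_le, W.map T, ?_, ?_⟩
  · have h1 := (h.isUnit_of_ne_zero (e.symm b) fun h0 => hb (by simpa using h0)).map e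
    rwa [RingEquiv.apply_symm_apply] at h1
  · exact ⟨T M, ⟨M, hM, rfl⟩, T N, ⟨N, hN, rfl⟩, fun h0 => hne (hT h0), by rw [hsub, hr]⟩
  · rintro r ⟨_, ⟨P, hP, rfl⟩, _, ⟨Q, hQ, rfl⟩, hPQ, rfl⟩
    exact hlow ⟨P, hP, Q, hQ, fun h0 => hPQ (by rw [h0]), hsub P Q⟩
  · rw [← hW]
    rfl
  · rw [← eL.finrank_eq, ← hdim]
    exact (Submodule.equivMapOfInjective T hT W).finrank_eq.symm

end Transfer

/-! ### The bound on `[D:F]`. -/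

section FixedField

variable {D : Type*} [DivisionRing D] [MulSemiringAction (Multiplicative ℕ) D]

/-- The inclusion of `F` in the center of `D`. -/
def fieldFToCenter : FieldF D →+* Subring.center D where
  toFun c := ⟨c.1, c.2.1⟩
  map_one' := rfl
  map_mul' _ _ := rfl
  map_zero' := rfl
  map_add' _ _ := rfl

/-- `D` has dimension at most `n [D : C]` over `F`, if `σ` has order at most `n` on the
center `C`. -/
theorem finite_and_finrank_le_of_iterate_center [Module.Finite (Subring.center D) D]
    (σ : D ≃+* D) (hσ : ∀ a, σ a = φ a) {n : ℕ} (hn : 0 < n)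
    (hfix : ∀ c ∈ Subring.center D, σ^[n] c = c) :
    Module.Finite (FieldF D) D ∧
      Module.finrank (FieldF D) D ≤ n * Module.finrank (Subring.center D) D := by
  let τ : RingAut (Subring.center D) := Subring.centerCongr σ
  have hτ : ∀ (j : ℕ) (c : Subring.center D), ((τ ^ j) c).1 = σ^[j] c.1 := fun j => by
    induction j with
    | zero => exact fun _ => rfl
    | succ j ih =>
      intro c
      rw [pow_succ, Function.iterate_succ_apply]
      exact ih (τ c)
  have hτn : τ ^ n = 1 := RingEquiv.ext fun c => Subtype.ext ((hτ n c).trans (hfix _ c.2))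
  have hfin : IsOfFinOrder τ := isOfFinOrder_iff_pow_eq_one.2 ⟨n, hn, hτn⟩
  have hle : orderOf τ ≤ n := orderOf_le_of_pow_eq_one hn hτn
  let G := Subgroup.zpowers τ
  have : Finite G := finite_zpowers.2 hfin
  let := Fintype.ofFinite G
  have hcard : Fintype.card G ≤ n := by
    rwa [← Nat.card_eq_fintype_card, Nat.card_zpowers]
  let : Algebra (FieldF D) (Subring.center D) := fieldFToCenter.toAlgebra
  have : IsScalarTower (FieldF D) (Subring.center D) D := ⟨fun a b c => mul_assoc a.1 b.1 c⟩
  let i : FieldF D ≃+* FixedPoints.subfield G (Subring.center D) :=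
    { toFun := fun c => ⟨⟨c.1, c.2.1⟩, by
        rintro ⟨_, j, rfl⟩
        have h1 : τ • (⟨c.1, c.2.1⟩ : Subring.center D) = ⟨c.1, c.2.1⟩ :=
          Subtype.ext ((hσ _).trans c.2.2)
        exact (Subgroup.zpowers_le (H := MulAction.stabilizer (RingAut (Subring.center D))
          (⟨c.1, c.2.1⟩ : Subring.center D))).2 h1 ⟨j, rfl⟩⟩
      invFun := fun c => ⟨c.1.1, c.1.2, (hσ _).symm.trans
        (congrArg Subtype.val (c.2 ⟨τ, Subgroup.mem_zpowers τ⟩))⟩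
      left_inv := fun _ => rfl
      right_inv := fun _ => rfl
      map_mul' := fun _ _ => rfl
      map_add' := fun _ _ => rfl }
  have hi : (algebraMap (FixedPoints.subfield G (Subring.center D)) (Subring.center D)).comp
      (i : FieldF D →+* _) =
      ((RingEquiv.refl (Subring.center D) : _ →+* Subring.center D)).comp
        (algebraMap (FieldF D) (Subring.center D)) := rfl
  have hrank := Algebra.finrank_eq_of_equiv_equiv i (RingEquiv.refl (Subring.center D)) hi
  -- Artin's bound: `F` is the fixed field in `C` of the cyclic group generated by `σ` restricted to
  -- `C`, a group of order at most `n`.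
  have hrank' := FixedPoints.finrank_le_card G (Subring.center D)
  have hfinite : Module.Finite (FieldF D) (Subring.center D) :=
    Module.Finite.of_equiv_equiv (A₁ := FixedPoints.subfield G (Subring.center D))
      i.symm (RingEquiv.refl (Subring.center D)) rfl
  refine ⟨Module.Finite.trans (Subring.center D) D, ?_⟩
  rw [← Module.finrank_mul_finrank (FieldF D) (Subring.center D) D, hrank]
  exact Nat.mul_le_mul_right _ (hrank'.trans hcard)

end FixedField

/-! ### The embedding of `F[x]/(ĥ)` in `B`. -/

section CentralNucleus

variable {D : Type*} [DivisionRing D] [MulSemiringAction (Multiplicative ℕ) D]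
variable {f : SkewPolynomial D}

theorem mk_mul_mk {p q : SkewPolynomial D} (hq : f * q ∈ Ideal.span {f}) :
    PetitAlgebra.mk f p * PetitAlgebra.mk f q = PetitAlgebra.mk f (p * q) := by
  rw [PetitAlgebra.mul_def', mk_eq_mk_iff, PetitAlgebra.val_mk, PetitAlgebra.val_mk]
  have h1 := Ideal.mul_mem_left _ (modR f p) (sub_modR_mem f q)
  have h2 := mul_mem_span_of_mem hq (sub_modR_mem f p)
  have h3 := neg_mem (add_mem h1 h2)
  rwa [mul_sub, sub_mul, add_comm, sub_add_sub_cancel, neg_sub] at h3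

variable {u : D} {n : ℕ}

/-- The class of the central element `u⁻¹ tⁿ` in `B`. -/
def nucGen (hm : 1 < natDegree f) (hf : coeff f (natDegree f) = 1)
    (hz : Commute (C u⁻¹ * X ^ n : SkewPolynomial D) f) : NucB f :=
  ⟨PetitAlgebra.mk f (C u⁻¹ * X ^ n), (mem_rightNucleus_iff hm hf).2 <| by
    have h1 := Ideal.mul_mem_left _ f (sub_modR_mem f (C u⁻¹ * X ^ n))
    have h2 := mul_mem_span (C u⁻¹ * X ^ n) f
    rw [hz.eq] at h2
    have h3 := sub_mem h2 h1
    rwa [mul_sub, sub_sub_cancel] at h3⟩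

theorem aeval_nucGen (hm : 1 < natDegree f) (hf : coeff f (natDegree f) = 1)
    (hz : Commute (C u⁻¹ * X ^ n : SkewPolynomial D) f) (q : (FieldF D)[X]) :
    (Polynomial.aeval (nucGen hm hf hz) q : NucB f).1 =
      PetitAlgebra.mk f (centralEval u n q) := by
  induction q using Polynomial.induction_on with
  | C a =>
    rw [centralEval, Polynomial.aeval_C, Polynomial.aeval_C, Algebra.algebraMap_eq_smul_one,
      Algebra.algebraMap_eq_smul_one, PetitAlgebra.mk_smul]
    rfl
  | add p q hp hq =>
    rw [centralEval, map_add, map_add, PetitAlgebra.mk_add, ← centralEval, ← centralEval, ← hp,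
      ← hq]
    rfl
  | monomial j a ih =>
    have hzf : f * (C u⁻¹ * X ^ n) ∈ Ideal.span {f} := hz.eq ▸ mul_mem_span _ _
    have h1 : (Polynomial.C a * Polynomial.X ^ (j + 1) : (FieldF D)[X]) =
        Polynomial.C a * Polynomial.X ^ j * Polynomial.X := by rw [pow_succ, mul_assoc]
    rw [h1, centralEval, map_mul _ _ Polynomial.X, map_mul _ _ Polynomial.X, Polynomial.aeval_X,
      Polynomial.aeval_X, ← centralEval, ← mk_mul_mk hzf, ← ih]
    rfl

/-- The remainder of `q` modulo `ĥ` still evaluates into `Rf`, so minimality of `ĥ` makes it zero.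
With the converse, the kernel of evaluation at the class of `u⁻¹tⁿ` is exactly `(ĥ)`. -/
theorem dvd_of_centralEval_mem (hn : 0 < n) (hu : u ≠ 0)
    (hun : ∀ z : D, φ^[n] z = u * z * u⁻¹) {h q : (FieldF D)[X]}
    (hh : IsMinCentralLeftMultiple u n f h) (hq : centralEval u n q ∈ Ideal.span {f}) :
    h ∣ q := by
  rw [← Polynomial.modByMonic_eq_zero_iff_dvd hh.monic]
  by_contra hne
  obtain ⟨g, hg⟩ := hh.mem
  have h1 : centralEval u n (q %ₘ h) =
      centralEval u n q - centralEval u n (q /ₘ h) * centralEval u n h := by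
    have h2 := congrArg (centralEval u n) (Polynomial.modByMonic_add_div q h)
    rw [mul_comm h, centralEval, map_add, map_mul] at h2
    exact eq_sub_of_add_eq h2
  have h3 : centralEval u n (q %ₘ h) ∈ Ideal.span {f} := by
    rw [h1, hg]
    exact sub_mem hq (Ideal.mul_mem_left _ _ (mul_mem_span g f))
  have h4 := hh.minimal _ hne (exists_eq_mul_of_mem_span h3)
  rw [natDegree_centralEval hn hun hu, natDegree_centralEval hn hun hu] at h4
  have h5 := Polynomial.degree_modByMonic_lt q hh.monic
  have h6 := Polynomial.natDegree_lt_natDegree hne h5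
  exact absurd (Nat.le_of_mul_le_mul_left h4 hn) (by omega)

/-- If `[B : F] ≤ deg ĥ`, then `F[x] / (ĥ) ≃ B` by sending `x` to the class of `u⁻¹ tⁿ`. -/
theorem exists_algEquiv_NucB (hm : 1 < natDegree f) (hf : coeff f (natDegree f) = 1)
    (hirr : Irreducible f) [Module.Finite (FieldF D) D] (hn : 0 < n) (hu : u ≠ 0)
    (hun : ∀ z : D, φ^[n] z = u * z * u⁻¹)
    (hz : Commute (C u⁻¹ * X ^ n : SkewPolynomial D) f) {h : (FieldF D)[X]}
    (hh : IsMinCentralLeftMultiple u n f h)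
    (hdim : Module.finrank (FieldF D) (NucB f) ≤ h.natDegree) :
    ∃ e : AdjoinRoot h ≃ₐ[FieldF D] NucB f,
      (e (AdjoinRoot.root h) : PetitAlgebra f) = PetitAlgebra.mk f (C u⁻¹ * X ^ n) := by
  have hzero : ∀ q : (FieldF D)[X], Polynomial.aeval (nucGen hm hf hz) q = 0 ↔ h ∣ q := by
    intro q
    constructor
    · intro h0
      have h1 := aeval_nucGen hm hf hz q
      rw [h0] at h1
      refine dvd_of_centralEval_mem hn hu hun hh ?_
      have h2 := mk_eq_mk_iff.1 (h1.symm.trans PetitAlgebra.mk_zero.symm)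
      rwa [sub_zero] at h2
    · rintro ⟨p, rfl⟩
      refine Subtype.ext ((aeval_nucGen hm hf hz _).trans ?_)
      obtain ⟨g, hg⟩ := hh.mem
      have h2 : centralEval u n (h * p) ∈ Ideal.span {f} := by
        rw [mul_comm, centralEval, map_mul, ← centralEval, ← centralEval, hg]
        exact Ideal.mul_mem_left _ _ (mul_mem_span g f)
      rw [(mk_eq_mk_iff (g' := 0)).2 (by rwa [sub_zero]), PetitAlgebra.mk_zero]
      rfl
  let T : AdjoinRoot h →ₐ[FieldF D] NucB f :=
    Ideal.Quotient.liftₐ (Ideal.span {h}) (Polynomial.aeval (nucGen hm hf hz)) fun q hq =>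
      (hzero q).2 (Ideal.mem_span_singleton.1 hq)
  have hTmk : ∀ q, T (AdjoinRoot.mk h q) = Polynomial.aeval (nucGen hm hf hz) q := fun _ => rfl
  have hinj : Function.Injective T := by
    refine (injective_iff_map_eq_zero T).2 fun x hx => ?_
    obtain ⟨q, rfl⟩ := AdjoinRoot.mk_surjective x
    rw [hTmk, hzero] at hx
    exact AdjoinRoot.mk_eq_zero.2 hx
  have := finite_NucB (FieldF D) hirr.ne_zero
  have hE : Module.finrank (FieldF D) (AdjoinRoot h) = h.natDegree := by
    rw [(AdjoinRoot.powerBasis' hh.monic).finrank, AdjoinRoot.powerBasis'_dim]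
  have : Module.Finite (FieldF D) (AdjoinRoot h) := (AdjoinRoot.powerBasis' hh.monic).finite
  -- Injectivity gives `deg ĥ ≤ [B:F]`; with the assumed reverse inequality the dimensions agree and
  -- `T` is onto.
  have hle := LinearMap.finrank_le_finrank_of_injective (f := T.toLinearMap) hinj
  have hsurj : Function.Surjective T :=
    (LinearMap.injective_iff_surjective_of_finrank_eq_finrank (f := T.toLinearMap)
      (le_antisymm hle (hE ▸ hdim))).1 hinj
  refine ⟨AlgEquiv.ofBijective T ⟨hinj, hsurj⟩, ?_⟩
  change (T (AdjoinRoot.mk h Polynomial.X)).1 = _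
  rw [hTmk, Polynomial.aeval_X]
  rfl

end CentralNucleus

/-! ### Compatibility of the `F'`- and `F`-structures on `B`. -/

section Tower

variable {D : Type*} [DivisionRing D] [MulSemiringAction (Multiplicative ℕ) D]

theorem isScalarTower_NucB (ρ : D ≃+* D) (f : SkewPolynomial D) :
    IsScalarTower (FieldF' ρ) (FieldF D) (NucB f) where
  smul_assoc a b x := Subtype.ext (PetitAlgebra.ext' (smul_assoc a b (x : PetitAlgebra f).val))

end Tower

end SkewMRD

end

/-! ### The main theorem. -/

open SkewMRD in
theorem mainTheorem1
    {D : Type*} [DivisionRing D] [MulSemiringAction (Multiplicative ℕ) D]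
    -- `D` is a division algebra of degree `d` over its center
    (d : ℕ) (hDfin : Module.Finite (Subring.center D) D)
    (hd : Module.finrank (Subring.center D) D = d ^ 2)
    -- `σ` is an automorphism of `D`, of order `n` modulo inner automorphisms
    (σ : D ≃+* D) (hσ : ∀ a, σ a = SkewPolynomial.φ a)
    (n : ℕ) (hn : 0 < n) (u : D) (hu : u ≠ 0) (hun : ∀ z, σ^[n] z = u * z * u⁻¹)
    (hn_min : ∀ j, 0 < j → j < n → ¬ ∃ w : D, w ≠ 0 ∧ ∀ z, σ^[j] z = w * z * w⁻¹)
    (hσu : σ u = u)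
    -- `f` is monic and irreducible of degree `m > 1`, not right-invariant, `(f, t)_r = 1`
    (f : SkewPolynomial D) (m : ℕ) (hm : 1 < m) (hfdeg : natDegree f = m) (hfmonic : f.coeff m = 1)
    (hf : Irreducible f) (hft : RightCoprime f SkewPolynomial.X) (hfinv : ¬ RightInvariant f)
    -- `h` is the minimal central left multiple of `f`, with `k` irreducible factors
    (hhat : (FieldF D)[X]) (hhhat : IsMinCentralLeftMultiple u n f hhat)
    (h : SkewPolynomial D) (hh : h = centralEval u n hhat)
    (k : ℕ) (hk : HasNumFactors h k)
    (ρ : D ≃+* D) (hρ : Module.Finite (FieldF' ρ) (FieldF D)) (ν : D)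
    (l : ℕ) (hl : 0 < l) (hlk : l < k)
    (hA : ¬ ∃ g ∈ setA ν ρ (l * m), natDegree g = l * m ∧ AllIrreducibleFactorsSimilar g f) :
    Nonempty (Module.Basis (Fin k) (NucB f)ᵐᵒᵖ (V f)) ∧
    (∀ v : Module.Basis (Fin k) (NucB f)ᵐᵒᵖ (V f),
      IsGenMRDCode (FieldF' ρ) (code v h (setS ν ρ (l * m) h)) (k - l + 1)) ∧
    (natDegree h = d * m * n →
      k = d * n ∧
      ∃ e : AdjoinRoot hhat ≃ₐ[FieldF D] NucB f,
        (e (AdjoinRoot.root hhat) : PetitAlgebra f) =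
          PetitAlgebra.mk f (SkewPolynomial.C u⁻¹ * SkewPolynomial.X ^ n) ∧
        ∀ v : Module.Basis (Fin (d * n)) (NucB f)ᵐᵒᵖ (V f),
          IsGenMRDCode (FieldF' ρ)
            ((fun M => M.map e.symm) '' code v h (setS ν ρ (l * m) h)) (d * n - l + 1)) := by
  have hσφ : (σ : D → D) = SkewPolynomial.φ := funext hσ
  have hφ : Function.Surjective (SkewPolynomial.φ : D → D) := hσφ ▸ σ.surjective
  have hfix : ∀ c ∈ Subring.center D, σ^[n] c = c := fun c hc => by
    rw [hun, Subring.mem_center_iff.1 hc u, mul_inv_cancel_right₀ hu]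
  obtain ⟨hFfin, hFrank⟩ := finite_and_finrank_le_of_iterate_center σ hσ hn hfix
  rw [hσφ] at hun hn_min hσu
  subst hfdeg
  have hann := annihilator_V_eq_span hφ hn hu hun hn_min hσu hm hf hhhat
  rw [← hh] at hann
  have hh0 : h ≠ 0 := hh ▸ centralEval_ne_zero hn hun hu hhhat.monic.ne_zero
  have hDF' : Module.Finite (FieldF' ρ) D := Module.Finite.trans (FieldF D) D
  have hρF' : ∀ c : FieldF' ρ, ρ (algebraMap (FieldF' ρ) D c) = algebraMap (FieldF' ρ) D c :=
    fun c => c.2.2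
  -- The index type is left free so that bases over both `Fin k` and `Fin (d * n)` are covered.
  have hcode : ∀ {ι : Type} [Fintype ι] (v : Module.Basis ι (NucB f)ᵐᵒᵖ (V f)),
      IsGenMRDCode (FieldF' ρ) (code v h (setS ν ρ (l * natDegree f) h)) (k - l + 1) := by
    intro ι _ v
    have hcard := card_eq_of_hasNumFactors hm hfmonic hf v hann hk
    rw [← hcard]
    exact isGenMRDCode_code (FieldF' ρ) hm hfmonic hf hh0 hann v ν ρ hρF' hl (hcard ▸ hlk) hA
  obtain ⟨b⟩ := nonempty_basis (FieldF D) hm hfmonic hf hann hk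
  refine ⟨⟨b⟩, fun v => hcode v, fun hdeg => ?_⟩
  have hdegk := natDegree_of_ker_evalMap (FieldF D) hm hfmonic hf b.linearIndependent hh0
    ((ker_evalMap_basis hm hfmonic b).trans hann)
  have hdegh : natDegree h = n * hhat.natDegree := by
    rw [hh]
    exact natDegree_centralEval hn hun hu hhat
  have hdimB := card_mul_finrank_NucB (FieldF D) hm hfmonic hf b
  rw [Fintype.card_fin] at hdegk hdimB
  have hm0 : 0 < natDegree f := by omega
  have hkdn : k = d * n := by
    refine Nat.eq_of_mul_eq_mul_right hm0 ?_
    rw [← hdegk, hdeg]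
    ring
  -- Positivity comes from `0 < l < k = dn`.
  have hd0 : 0 < d * n := by omega
  have hhatdeg : hhat.natDegree = natDegree f * d := by
    refine Nat.eq_of_mul_eq_mul_left hn ?_
    rw [← hdegh, hdeg]
    ring
  -- From `dn[B:F] = m[D:F] ≤ m · n · d²`, cancel `dn` to get `[B:F] ≤ md = deg ĥ`.
  have hdim : Module.finrank (FieldF D) (NucB f) ≤ hhat.natDegree := by
    refine Nat.le_of_mul_le_mul_left ?_ hd0
    rw [← hkdn, hdimB, hhatdeg, hkdn]
    refine (Nat.mul_le_mul_left _ hFrank).trans (le_of_eq ?_)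
    rw [hd]
    ring
  obtain ⟨e, he⟩ := exists_algEquiv_NucB hm hfmonic hf hn hu hun
    (commute_C_inv_mul_X_pow hun hu hσu f) hhhat hdim
  refine ⟨hkdn, e, he, fun v => ?_⟩
  have hv := hcode v
  rw [hkdn] at hv
  have := isScalarTower_NucB ρ f
  refine hv.map e.symm.toRingEquiv fun c x => ?_
  change e.symm (c • x) = c • e.symm x
  -- `e` is only known to be `F`-linear, so the scalar from `F'` is passed through `F`.
  rw [← algebraMap_smul (FieldF D) c x, map_smul, algebraMap_smul]
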